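/- Let $k$ be a field of characteristic zero and let $Ch$ be the category of $\mathbb Z$-graded chain complexes over $k$. Let $R$ be the category whose objects are the finite rooted trees all of whose vertices have at least two inputs (including the tree $\eta$ with one edge and no vertex), and whose morphisms are the maps of trees that preserve the root, i.e. the composites of isomorphisms, inner faces (which contract an inner edge of the target) and external faces (which chop off a top vertex of the target). Write $Psh(R)$ for the category of functors $R^{op}\to Ch$, and $CoPsh^c(R)$ for the category of the functors $N:R\to Ch$ that are conilpotent: for each $S$ and each $y\in N(S)$ there are, up to isomorphism under $S$, only finitely many $\alpha:S\to T$ with $\alpha_*(y)\neq 0$. For a tree $T$ let $en^+_T$ be the set of enumerations $e=(e_1,\dots,e_p)$ of the root and the inner edges of $T$ (with $p=0$ for $T=\eta$). For a function $f$ on the maps $d$ out of $T$ that is invariant under isomorphism under $T$, write $\int_d f(d)=\sum_{[d]}\frac{1}{|\mathrm{Aut}_T(d)|}f(d)$, a sum over isomorphism classes under $T$. Bar construction. For $M\in Psh(R)$, let $B(M)(S)_n$ be the space of families $\omega=(\omega_\alpha(e))$, with $\omega_\alpha(e)\in M(T)_{n-p}$ for each $\alpha:S\to T$ and $e=(e_1,\dots,e_p)\in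 en^+_T$, such that $\omega_\alpha(e\sigma)=(-1)^\sigma\omega_\alpha(e)$ for permutations $\sigma$, $\omega_\alpha(e)=\gamma^*\omega_{\gamma\alpha}(\gamma e)$ for isomorphisms $\gamma:T\to T'$, and, up to isomorphism under $S$, $\omega_\alpha\ne0$ for only finitely many $\alpha$. Put $$(\partial\omega)_\alpha(e)=\partial(\omega_\alpha(e))+(-1)^n\int_{d}d^*\omega_{d\alpha}(de)-(-1)^n\int_{v}v^*\omega_{v\alpha}(de),\qquad \beta_*(\omega)_\alpha(e)=\omega_{\alpha\beta}(e).$$ Here $d:T\to T'$ runs over the inner faces contracting one inner edge (also called $d$) of $T'$, and $v:T\to T'$ over the external faces chopping off one top vertex of $T'$, with output edge called $d$ (a leaf of $T$); and $de=(d,e_1,\dots,e_p)\in en^+_{T'}$. Cobar construction. For $N\in CoPsh^c(R)$, let $\Omega(N)(S)$ be spanned by the symbols $(\alpha,y\otimes e)$, linear in $y$, of degree $|y|-p$, with $\alpha:S\to T$, $y\in N(T)$ and $e=(e_1,\dots,e_p)\in en^+_T$, modulo $(\alpha,y\otimes e)=(-1)^\sigma(\alpha,y\otimes e\sigma)$ and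 $(\alpha,y\otimes e)=(\gamma\alpha,\gamma_*y\otimes\gamma e)$ for isomorphisms $\gamma:T\to T'$. Put $$\partial(\alpha,y\otimes e)=(\alpha,\partial y\otimes e)+(-1)^{|y|}\int_d(d\alpha,d_*y\otimes de)-(-1)^{|y|}\int_v(v\alpha,v_*y\otimes de),\qquad \beta^*(\alpha,y\otimes e)=(\alpha\beta,y\otimes e),$$ with $d$, $v$ and $de$ as above; these sums are finite because $N$ is conilpotent. Proposition. These formulas, with the evident action on morphisms of (co)presheaves, define functors $B:Psh(R)\to CoPsh^c(R)$ and $\Omega:CoPsh^c(R)\to Psh(R)$, and $\Omega$ is left adjoint to $B$. -/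

import Mathlib

open CategoryTheory Opposite

universe u v

namespace BarCobar

/-! ### The category of open reduced trees and root preserving maps -/

/-- The set of labels `{0, …, n-1}`, as a bare set, without its usual order. -/
def Label (n : ℕ) : Type := Fin n

instance (n : ℕ) : Fintype (Label n) := inferInstanceAs (Fintype (Fin n))

/-- An open reduced tree, given by its finite set of edges. `a ≤ b` means that the edge `a` lies on
the path from the edge `b` down to the root, so `⊥` is the root. As the tree is open (no vertices of
valence zero), the leaves are exactly the maximal edges and each other edge `a` is the output edge
of exactly one vertex; the input edges of this vertex are the edges covering `a`. The tree is
reduced: each vertex has at least two inputs. The tree `η` is the one with a single edge. -/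
structure RTree where
  /-- the number of edges -/
  size : ℕ
  [order : PartialOrder (Label size)]
  [root : OrderBot (Label size)]
  chain : ∀ a b c : Label size, a ≤ c → b ≤ c → a ≤ b ∨ b ≤ a
  reduced : ∀ a : Label size, ¬ IsMax a → ∃ b c, b ≠ c ∧ a ⋖ b ∧ a ⋖ c

/-- The set of edges of a tree. -/
def RTree.Edge (T : RTree) : Type := Label T.size

instance (T : RTree) : Fintype T.Edge := inferInstanceAs (Fintype (Label T.size))
instance (T : RTree) : PartialOrder T.Edge := T.order
instance (T : RTree) : OrderBot T.Edge := T.root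

/-- A morphism of the category of trees that preserves the root. A map of trees sends edges to edges
and the vertex above `a`, with inputs `b₁, …, bₙ`, to a subtree with root `f a` whose leaves
are `f b₁, …, f bₙ`. For open reduced trees this says that `f` is an order embedding and that each
leaf of the target above `f a` is above some `f bᵢ`. -/
@[ext]
structure RTree.Hom (S T : RTree) where
  toEmb : S.Edge ↪o T.Edge
  map_root : toEmb ⊥ = ⊥
  vertex : ∀ a : S.Edge, ¬ IsMax a → ∀ t : T.Edge, IsMax t → toEmb a ≤ t →
    ∃ b, a ⋖ b ∧ toEmb b ≤ t

theorem RTree.Hom.not_isMax {S T : RTree} (f : S.Hom T) {a : S.Edge} (h : ¬ IsMax a) :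
    ¬ IsMax (f.toEmb a) := by
  rw [not_isMax_iff] at h ⊢
  obtain ⟨b, hb⟩ := h
  exact ⟨f.toEmb b, f.toEmb.lt_iff_lt.2 hb⟩

/-- The identity map. -/
def RTree.Hom.id (T : RTree) : T.Hom T where
  toEmb := RelEmbedding.refl _
  map_root := rfl
  vertex a ha t ht hat := by
    have hlt : a < t := lt_of_le_of_ne hat (by rintro rfl; exact ha ht)
    obtain ⟨b, hb, hbt⟩ := exists_covBy_le_of_lt hlt
    exact ⟨b, hb, hbt⟩

/-- Composition of maps of trees. -/
def RTree.Hom.comp {R S T : RTree} (f : R.Hom S) (g : S.Hom T) : R.Hom T where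
  toEmb := f.toEmb.trans g.toEmb
  map_root := by simp [f.map_root, g.map_root]
  vertex a ha t ht hat := by
    classical
    obtain ⟨u, hu, hmax⟩ := (Set.toFinite {u : S.Edge | f.toEmb a ≤ u ∧ g.toEmb u ≤ t}).exists_le_maximal
      (a := f.toEmb a) ⟨le_rfl, hat⟩
    have hu' : IsMax u := by
      by_contra hn
      obtain ⟨b, hb, hbt⟩ := g.vertex u hn t ht hmax.prop.2
      exact hb.lt.not_ge (hmax.2 ⟨hu.trans hb.le, hbt⟩ hb.le)
    obtain ⟨b, hb, hbu⟩ := f.vertex a ha u hu' hu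
    exact ⟨b, hb, (g.toEmb.le_iff_le.2 hbu).trans hmax.prop.2⟩

/-- The category of open reduced trees and root preserving maps. -/
instance : Category RTree where
  Hom := RTree.Hom
  id := RTree.Hom.id
  comp := RTree.Hom.comp

/-- The effect of a map of trees on edges. -/
def edgeMap {S T : RTree} (f : S ⟶ T) : S.Edge ↪o T.Edge := RTree.Hom.toEmb f

/-! ### Elementary faces and enumerations -/

/-- `d : T ⟶ T'` is the inner face that contracts the inner edge `b` of `T'`. -/
def IsInnerFace {T T' : RTree} (d : T ⟶ T') (b : T'.Edge) : Prop :=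
  b ≠ ⊥ ∧ ¬ IsMax b ∧ Set.range (edgeMap d) = {x | x ≠ b}

/-- `d : T ⟶ T'` is the external face that chops off the top vertex of `T'` whose output edge is
`b`, together with its inputs (all of which are leaves); thus `b` is a leaf of `T`. -/
def IsTopFace {T T' : RTree} (d : T ⟶ T') (b : T'.Edge) : Prop :=
  ¬ IsMax b ∧ (∀ x, b < x → IsMax x) ∧ Set.range (edgeMap d) = {x | ¬ b < x}

/-- The edges of `T'` that are not leaves are `b` and the images of those of `T`. -/
def IsNewEdge {T T' : RTree} (d : T ⟶ T') (b : T'.Edge) : Prop :=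
  (∀ a, ¬ IsMax a → edgeMap d a ≠ b) ∧
    ∀ x, ¬ IsMax x ↔ x = b ∨ ∃ a, ¬ IsMax a ∧ edgeMap d a = x

theorem IsInnerFace.isNewEdge {T T' : RTree} {d : T ⟶ T'} {b : T'.Edge} (h : IsInnerFace d b) :
    IsNewEdge d b := by
  obtain ⟨-, hb, hr⟩ := h
  have hr' : ∀ x, (∃ a, edgeMap d a = x) ↔ x ≠ b := fun x => Set.ext_iff.1 hr x
  refine ⟨fun a _ => (hr' _).1 ⟨a, rfl⟩, fun x => ⟨fun hx => ?_, ?_⟩⟩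
  · by_cases hxb : x = b
    · exact Or.inl hxb
    · right
      obtain ⟨a, rfl⟩ := (hr' x).2 hxb
      refine ⟨a, fun ha => hx ?_, rfl⟩
      have key : ∀ y, y ≠ b → ¬ edgeMap d a < y := by
        intro y hy hlt
        obtain ⟨c, rfl⟩ := (hr' y).2 hy
        exact ha.not_lt ((edgeMap d).lt_iff_lt.1 hlt)
      rw [isMax_iff_forall_not_lt]
      intro y hy
      by_cases hyb : y = b
      · subst hyb
        obtain ⟨z, hz⟩ := not_isMax_iff.1 hb
        exact key z hz.ne' (hy.trans hz)
      · exact key y hyb hy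
  · rintro (rfl | ⟨a, ha, rfl⟩)
    · exact hb
    · exact RTree.Hom.not_isMax d ha

theorem IsTopFace.isNewEdge {T T' : RTree} {d : T ⟶ T'} {b : T'.Edge} (h : IsTopFace d b) :
    IsNewEdge d b := by
  obtain ⟨hb, htop, hr⟩ := h
  have hr' : ∀ x, (∃ a, edgeMap d a = x) ↔ ¬ b < x := fun x => Set.ext_iff.1 hr x
  refine ⟨?_, fun x => ⟨fun hx => ?_, ?_⟩⟩
  · rintro a ha rfl
    obtain ⟨c, hc⟩ := not_isMax_iff.1 ha
    exact (hr' (edgeMap d c)).1 ⟨c, rfl⟩ ((edgeMap d).lt_iff_lt.2 hc)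
  · by_cases hxb : x = b
    · exact Or.inl hxb
    · right
      have hbx : ¬ b < x := fun hlt => hx (htop x hlt)
      obtain ⟨a, rfl⟩ := (hr' x).2 hbx
      refine ⟨a, fun ha => hx ?_, rfl⟩
      have key : ∀ y, ¬ b < y → ¬ edgeMap d a < y := by
        intro y hy hlt
        obtain ⟨c, rfl⟩ := (hr' y).2 hy
        exact ha.not_lt ((edgeMap d).lt_iff_lt.1 hlt)
      rw [isMax_iff_forall_not_lt]
      intro y hy
      by_cases hyb : b < y
      · rcases T'.chain _ _ _ hy.le hyb.le with h1 | h1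
        · exact key b (lt_irrefl b) (lt_of_le_of_ne h1 hxb)
        · exact hbx (lt_of_le_of_ne h1 (Ne.symm hxb))
      · exact key y hyb hy
  · rintro (rfl | ⟨a, ha, rfl⟩)
    · exact hb
    · exact RTree.Hom.not_isMax d ha

/-- The enumerations `(e₁, …, e_p)` of length `p` of the root and the inner edges of `T`, that is, of
all the edges that are not leaves. (The only edge of `η` counts as a leaf.) -/
@[ext]
structure Enum (T : RTree) (p : ℕ) where
  edge : Fin p → T.Edge
  injective : Function.Injective edge
  mem_iff : ∀ x, ¬ IsMax x ↔ ∃ i, edge i = x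

/-- The permuted enumeration `eσ`. -/
def Enum.perm {T : RTree} {p : ℕ} (e : Enum T p) (σ : Equiv.Perm (Fin p)) : Enum T p where
  edge := e.edge ∘ σ
  injective := e.injective.comp σ.injective
  mem_iff x := by
    rw [e.mem_iff]
    exact σ.surjective.exists (p := fun i => e.edge i = x)

theorem isMax_iso_iff {T T' : RTree} (γ : T ≅ T') (a : T.Edge) :
    IsMax (edgeMap γ.hom a) ↔ IsMax a := by
  have hinv : ∀ {A B : RTree} (δ : A ≅ B) (x : A.Edge), edgeMap δ.inv (edgeMap δ.hom x) = x :=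
    fun δ x => congrArg (fun g => edgeMap g x) δ.hom_inv_id
  refine ⟨fun h => ?_, fun h => ?_⟩
  · by_contra hn
    exact RTree.Hom.not_isMax γ.hom hn h
  · by_contra hn
    have := RTree.Hom.not_isMax γ.inv hn
    exact this ((hinv γ a).symm ▸ h)

/-- The enumeration `γe` of `T'` induced by an isomorphism `γ : T ≅ T'`. -/
def Enum.transport {T T' : RTree} {p : ℕ} (e : Enum T p) (γ : T ≅ T') : Enum T' p where
  edge := edgeMap γ.hom ∘ e.edge
  injective := (edgeMap γ.hom).injective.comp e.injective
  mem_iff x := by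
    have hx : edgeMap γ.hom (edgeMap γ.inv x) = x :=
      congrArg (fun g => edgeMap g x) γ.inv_hom_id
    rw [← hx, isMax_iso_iff, e.mem_iff]
    simp

/-- The enumeration `de = (d, e₁, …, e_p)` of `T'`, for a face `d : T ⟶ T'` with new edge `b`. -/
def Enum.cons {T T' : RTree} {p : ℕ} (e : Enum T p) (d : T ⟶ T') (b : T'.Edge)
    (h : IsNewEdge d b) : Enum T' (p + 1) where
  edge := Fin.cons b (edgeMap d ∘ e.edge)
  injective := by
    rw [Fin.cons_injective_iff]
    refine ⟨?_, (edgeMap d).injective.comp e.injective⟩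
    rintro ⟨i, hi⟩
    exact h.1 (e.edge i) ((e.mem_iff _).2 ⟨i, rfl⟩) hi
  mem_iff x := by
    rw [h.2 x, Fin.exists_fin_succ]
    simp only [Fin.cons_zero, Fin.cons_succ, Function.comp_apply, e.mem_iff]
    constructor
    · rintro (rfl | ⟨_, ⟨i, rfl⟩, rfl⟩)
      · exact Or.inl rfl
      · exact Or.inr ⟨i, rfl⟩
    · rintro (rfl | ⟨i, rfl⟩)
      · exact Or.inl rfl
      · exact Or.inr ⟨_, ⟨i, rfl⟩, rfl⟩

/-- The isomorphism classes of maps of trees out of `S`, under isomorphisms under `S`. -/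
abbrev ArrowClass (S : RTree) : Type := Quotient (isIsomorphicSetoid (Under S))

/-- The isomorphism class of a map of trees out of `S`. -/
def arrowClass {S T : RTree} (α : S ⟶ T) : ArrowClass S :=
  Quotient.mk (isIsomorphicSetoid (Under S)) (Under.mk α)

/-- The weighted sum `∫_d f(d)` over all maps of trees `d` out of `T`: the sum over the isomorphism
classes of such maps, that of `d` with weight `1 / |Aut_T(d)|`. It is used for functions
`f` that are invariant under isomorphism and vanish on all but finitely many classes. -/
noncomputable def weightedSum (k : Type u) [Field k] {T : RTree} {V : Type v} [AddCommGroup V]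
    [Module k V] (f : Under T → V) : V :=
  ∑ᶠ x : ArrowClass T, ((Nat.card (Aut x.out) : k))⁻¹ • f x.out

/-! ### Presheaves and conilpotent copresheaves -/

/-- Presheaves on the category of trees with values in chain complexes over `k`. -/
abbrev Psh (k : Type u) [Field k] := RTreeᵒᵖ ⥤ ChainComplex (ModuleCat.{v} k) ℤ

/-- Copresheaves on the category of trees with values in chain complexes over `k`. -/
abbrev CoPsh (k : Type u) [Field k] := RTree ⥤ ChainComplex (ModuleCat.{v} k) ℤ

/-- A copresheaf `N` is conilpotent if for each `y` in `N(S)` there are, up to isomorphism under `S`,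
only finitely many maps `α : S ⟶ T` with `α_*(y) ≠ 0`. -/
def IsConilpotent (k : Type u) [Field k] : ObjectProperty (CoPsh.{u, v} k) := fun N =>
  ∀ (S : RTree) (n : ℤ) (y : (N.obj S).X n),
    {x : ArrowClass S | ∃ (T : RTree) (α : S ⟶ T),
      arrowClass α = x ∧ ((N.map α).f n).hom y ≠ 0}.Finite

/-- The full subcategory of conilpotent copresheaves. -/
abbrev ConilpCoPsh (k : Type u) [Field k] := (IsConilpotent.{u, v} k).FullSubcategory

/-- The index `(α, e)`, with `α : S ⟶ T` and `e ∈ en⁺_T` of length `len`, together with the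
degree `deg` of the elements placed at this index. -/
structure Cell (S : RTree) where
  tree : RTree
  map : S ⟶ tree
  len : ℕ
  enum : Enum tree len
  deg : ℤ

namespace Cell

variable {S : RTree}

/-- `(α, eσ)` -/
abbrev perm (c : Cell S) (σ : Equiv.Perm (Fin c.len)) : Cell S :=
  { c with enum := c.enum.perm σ }

/-- `(γα, γe)` -/
abbrev transport (c : Cell S) {T' : RTree} (γ : c.tree ≅ T') : Cell S where
  tree := T'
  map := c.map ≫ γ.hom
  len := c.len
  enum := c.enum.transport γ
  deg := c.deg

/-- `(dα, de)` -/
abbrev face (c : Cell S) {T' : RTree} (d : c.tree ⟶ T') (b : T'.Edge) (h : IsNewEdge d b) : Cell S where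
  tree := T'
  map := c.map ≫ d
  len := c.len + 1
  enum := c.enum.cons d b h
  deg := c.deg

/-- `(αβ, e)` -/
abbrev precomp (c : Cell S) {R : RTree} (β : R ⟶ S) : Cell R where
  tree := c.tree
  map := β ≫ c.map
  len := c.len
  enum := c.enum
  deg := c.deg

/-- The same index `(α, e)`, for elements of degree `m`. -/
abbrev withDeg (c : Cell S) (m : ℤ) : Cell S := { c with deg := m }

end Cell

/-! ### The bar construction -/

section Bar

variable {k : Type u} [Field k]

/-- The indices of the elements `ω_α(e)` for `ω` of degree `n`; such an element has degree `n - p`,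
for `p` the length of `e`. -/
abbrev BarCell (S : RTree) (n : ℤ) : Type := {c : Cell S // c.deg + c.len = n}

/-- Families `ω = (ω_α(e))` of degree `n`, with `ω_α(e) ∈ M(T)_{n-p}`. -/
abbrev BarFamily (M : Psh.{u, v} k) (S : RTree) (n : ℤ) : Type v :=
  ∀ c : BarCell S n, (M.obj (op c.1.tree)).X c.1.deg

/-- The degree `n` part of the bar construction of `M` at `S`: the families `ω` with
`ω_α(eσ) = (-1)^σ ω_α(e)` and `ω_α(e) = γ^* ω_{γα}(γe)` for isomorphisms `γ`, which are
finitely supported: up to isomorphism, `ω_α` is zero for all but finitely many `α`. -/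
def barModule (M : Psh.{u, v} k) (S : RTree) (n : ℤ) : Submodule k (BarFamily M S n) where
  carrier := {ω |
    (∀ (c : BarCell S n) (σ : Equiv.Perm (Fin c.1.len)),
      ω ⟨c.1.perm σ, c.2⟩ = Equiv.Perm.sign σ • ω c) ∧
    (∀ (c : BarCell S n) (T' : RTree) (γ : c.1.tree ≅ T'),
      ω c = ((M.map γ.hom.op).f c.1.deg).hom (ω ⟨c.1.transport γ, c.2⟩)) ∧
    {x : ArrowClass S | ∃ c : BarCell S n, arrowClass c.1.map = x ∧ ω c ≠ 0}.Finite}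
  zero_mem' := by
    refine ⟨fun c σ => ?_, fun c T' γ => ?_, ?_⟩
    · simp
    · simp
    · simp
  add_mem' := by
    rintro a b ⟨ha1, ha2, ha3⟩ ⟨hb1, hb2, hb3⟩
    refine ⟨fun c σ => ?_, fun c T' γ => ?_, (ha3.union hb3).subset ?_⟩
    · rw [Pi.add_apply, Pi.add_apply, ha1, hb1, smul_add]
    · rw [Pi.add_apply, Pi.add_apply, map_add, ← ha2, ← hb2]
    · rintro x ⟨c, hc, hne⟩
      by_cases h : a c = 0
      · exact Or.inr ⟨c, hc, fun h' => hne (by rw [Pi.add_apply, h, h', add_zero])⟩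
      · exact Or.inl ⟨c, hc, h⟩
  smul_mem' := by
    rintro r a ⟨ha1, ha2, ha3⟩
    refine ⟨fun c σ => ?_, fun c T' γ => ?_, ha3.subset ?_⟩
    · rw [Pi.smul_apply, Pi.smul_apply, ha1, smul_comm]
    · rw [Pi.smul_apply, Pi.smul_apply, map_smul, ← ha2]
    · rintro x ⟨c, hc, hne⟩
      exact ⟨c, hc, fun h => hne (by rw [Pi.smul_apply, h, smul_zero])⟩

/-- The differential of the bar construction: for `ω` of degree `n`,
`(∂ω)_α(e) = ∂(ω_α(e)) + (-1)^n ∫_d d^* ω_{dα}(de) - (-1)^n ∫_v v^* ω_{vα}(de)`,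
where `d` runs over the inner faces `d : T ⟶ T'` with one more inner edge `b = d` and `v`
over the external faces `T ⟶ T'` chopping off a top vertex of `T'` with output edge `b = d`. -/
noncomputable def barDiff (M : Psh.{u, v} k) (S : RTree) (n : ℤ) (ω : BarFamily M S n) :
    BarFamily M S (n - 1) := fun c =>
  ((M.obj (op c.1.tree)).d (c.1.deg + 1) c.1.deg).hom
      (ω ⟨c.1.withDeg (c.1.deg + 1), by have := c.2; dsimp only; omega⟩)
    + n.negOnePow • weightedSum k (fun X : Under c.1.tree =>
        ∑ᶠ (b : X.right.Edge) (h : IsInnerFace (T := c.1.tree) (T' := X.right) X.hom b),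
          ((M.map (Quiver.Hom.op (X := c.1.tree) (Y := X.right) X.hom)).f c.1.deg).hom
            (ω ⟨c.1.face X.hom b h.isNewEdge, by
              have := c.2; push_cast; omega⟩))
    - n.negOnePow • weightedSum k (fun X : Under c.1.tree =>
        ∑ᶠ (b : X.right.Edge) (h : IsTopFace (T := c.1.tree) (T' := X.right) X.hom b),
          ((M.map (Quiver.Hom.op (X := c.1.tree) (Y := X.right) X.hom)).f c.1.deg).hom
            (ω ⟨c.1.face X.hom b h.isNewEdge, by
              have := c.2; push_cast; omega⟩))

/-- `B` is the bar functor: its value at `M`, `S` in degree `n` is (identified by `Φ` with) the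
module `barModule M S n`, with the differential `barDiff`, with the copresheaf structure
`β_*(ω)_α(e) = ω_{αβ}(e)`, and with the action `(f_* ω)_α(e) = f(ω_α(e))` of morphisms `f`. This
determines `B` up to a unique isomorphism compatible with the identifications. -/
def IsBarFunctor (B : Psh.{u, v} k ⥤ ConilpCoPsh.{u, v} k) : Prop :=
  ∃ Φ : ∀ (M : Psh.{u, v} k) (S : RTree) (n : ℤ),
      (((B.obj M).obj.obj S).X n) ≃ₗ[k] barModule M S n,
    (∀ (M : Psh.{u, v} k) (S : RTree) (n : ℤ) (x : ((B.obj M).obj.obj S).X n),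
      (Φ M S (n - 1) ((((B.obj M).obj.obj S).d n (n - 1)).hom x)).1
        = barDiff M S n (Φ M S n x).1) ∧
    (∀ (M : Psh.{u, v} k) (S R : RTree) (β : S ⟶ R) (n : ℤ) (x : ((B.obj M).obj.obj S).X n)
      (c : BarCell R n),
      (Φ M R n ((((B.obj M).obj.map β).f n).hom x)).1 c
        = (Φ M S n x).1 ⟨c.1.precomp β, c.2⟩) ∧
    (∀ (M M' : Psh.{u, v} k) (f : M ⟶ M') (S : RTree) (n : ℤ) (x : ((B.obj M).obj.obj S).X n)
      (c : BarCell S n),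
      (Φ M' S n ((((B.map f).hom.app S).f n).hom x)).1 c
        = ((f.app (op c.1.tree)).f c.1.deg).hom ((Φ M S n x).1 c))

end Bar

/-! ### The cobar construction -/

section Cobar

variable {k : Type u} [Field k]

/-- The indices of the generators `(α, y ⊗ e)` of degree `n`; here `y` has degree `n + p`, for `p`
the length of `e`. -/
abbrev CobarCell (S : RTree) (n : ℤ) : Type := {c : Cell S // c.deg - c.len = n}

open Classical in
/-- The element `(α, y ⊗ e)` of the direct sum over all `(α, e)`. -/
noncomputable def cobarLof (N : CoPsh.{u, v} k) (S : RTree) (n : ℤ) (c : CobarCell S n)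
    (y : (N.obj c.1.tree).X c.1.deg) :
    DirectSum (CobarCell S n) (fun c => (N.obj c.1.tree).X c.1.deg) :=
  DirectSum.lof k (CobarCell S n) (fun c => (N.obj c.1.tree).X c.1.deg) c y

/-- The relations `(α, y ⊗ e) = (-1)^σ (α, y ⊗ eσ)` for permutations `σ`, and
`(α, y ⊗ e) = (γα, γ_* y ⊗ γe)` for isomorphisms `γ`. -/
def cobarRel (N : CoPsh.{u, v} k) (S : RTree) (n : ℤ) :
    Submodule k (DirectSum (CobarCell S n) (fun c => (N.obj c.1.tree).X c.1.deg)) :=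
  Submodule.span k
    ({z | ∃ (c : CobarCell S n) (σ : Equiv.Perm (Fin c.1.len)) (y : (N.obj c.1.tree).X c.1.deg),
        z = cobarLof N S n c y - Equiv.Perm.sign σ • cobarLof N S n ⟨c.1.perm σ, c.2⟩ y} ∪
     {z | ∃ (c : CobarCell S n) (T' : RTree) (γ : c.1.tree ≅ T')
          (y : (N.obj c.1.tree).X c.1.deg),
        z = cobarLof N S n c y -
          cobarLof N S n ⟨c.1.transport γ, c.2⟩ (((N.map γ.hom).f c.1.deg).hom y)})

/-- The degree `n` part of the cobar construction of `N` at `S`: the coinvariants of the direct sum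
of the `N(T)[-e]` over all `α : S ⟶ T` and `e ∈ en⁺_T`. -/
abbrev cobarModule (N : CoPsh.{u, v} k) (S : RTree) (n : ℤ) : Type v :=
  DirectSum (CobarCell S n) (fun c => (N.obj c.1.tree).X c.1.deg) ⧸ cobarRel N S n

/-- The class of `(α, y ⊗ e)` in the cobar construction. -/
noncomputable def cobarMk (N : CoPsh.{u, v} k) (S : RTree) (n : ℤ) (c : CobarCell S n)
    (y : (N.obj c.1.tree).X c.1.deg) : cobarModule N S n :=
  (cobarRel N S n).mkQ (cobarLof N S n c y)

/-- The differential of the cobar construction on generators: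
`∂(α, y ⊗ e) = (α, ∂y ⊗ e) + (-1)^y ∫_d (dα, d_* y ⊗ de) - (-1)^y ∫_v (vα, v_* y ⊗ de)`,
where `d` and `v` run over the same faces as in the differential of the bar construction. -/
noncomputable def cobarDiff (N : CoPsh.{u, v} k) (S : RTree) (n : ℤ) (c : CobarCell S n)
    (y : (N.obj c.1.tree).X c.1.deg) : cobarModule N S (n - 1) :=
  cobarMk N S (n - 1)
      ⟨c.1.withDeg (c.1.deg - 1), by have := c.2; dsimp only; omega⟩
      (((N.obj c.1.tree).d c.1.deg (c.1.deg - 1)).hom y)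
    + c.1.deg.negOnePow • weightedSum k (fun X : Under c.1.tree =>
        ∑ᶠ (b : X.right.Edge) (h : IsInnerFace (T := c.1.tree) (T' := X.right) X.hom b),
          cobarMk N S (n - 1)
            ⟨c.1.face X.hom b h.isNewEdge, by
              have := c.2; push_cast; omega⟩
            (((N.map (X := c.1.tree) (Y := X.right) X.hom).f c.1.deg).hom y))
    - c.1.deg.negOnePow • weightedSum k (fun X : Under c.1.tree =>
        ∑ᶠ (b : X.right.Edge) (h : IsTopFace (T := c.1.tree) (T' := X.right) X.hom b),
          cobarMk N S (n - 1)
            ⟨c.1.face X.hom b h.isNewEdge, by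
              have := c.2; push_cast; omega⟩
            (((N.map (X := c.1.tree) (Y := X.right) X.hom).f c.1.deg).hom y))

/-- `Ω` is the cobar functor: its value at `N`, `S` in degree `n` is (identified by `Ψ` with) the
module `cobarModule N S n`, with the differential given by `cobarDiff` on generators, with the
presheaf structure `β^*(α, y ⊗ e) = (αβ, y ⊗ e)`, and with the action
`f_*(α, y ⊗ e) = (α, f(y) ⊗ e)` of morphisms `f`. This determines `Ω` up to a unique isomorphism
compatible with the identifications. -/
def IsCobarFunctor (Ω : ConilpCoPsh.{u, v} k ⥤ Psh.{u, v} k) : Prop :=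
  ∃ Ψ : ∀ (N : ConilpCoPsh.{u, v} k) (S : RTree) (n : ℤ),
      cobarModule N.obj S n ≃ₗ[k] (((Ω.obj N).obj (op S)).X n),
    (∀ (N : ConilpCoPsh.{u, v} k) (S : RTree) (n : ℤ) (c : CobarCell S n)
      (y : (N.obj.obj c.1.tree).X c.1.deg),
      (((Ω.obj N).obj (op S)).d n (n - 1)).hom (Ψ N S n (cobarMk N.obj S n c y))
        = Ψ N S (n - 1) (cobarDiff N.obj S n c y)) ∧
    (∀ (N : ConilpCoPsh.{u, v} k) (R S : RTree) (β : R ⟶ S) (n : ℤ) (c : CobarCell S n)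
      (y : (N.obj.obj c.1.tree).X c.1.deg),
      (((Ω.obj N).map β.op).f n).hom (Ψ N S n (cobarMk N.obj S n c y))
        = Ψ N R n (cobarMk N.obj R n ⟨c.1.precomp β, c.2⟩ y)) ∧
    (∀ (N N' : ConilpCoPsh.{u, v} k) (f : N ⟶ N') (S : RTree) (n : ℤ) (c : CobarCell S n)
      (y : (N.obj.obj c.1.tree).X c.1.deg),
      (((Ω.map f).app (op S)).f n).hom (Ψ N S n (cobarMk N.obj S n c y))
        = Ψ N' S n (cobarMk N'.obj S n c (((f.hom.app c.1.tree).f c.1.deg).hom y)))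

end Cobar

end BarCobar

namespace BarCobar

/-! ### Labelled maps of trees -/

/-! Both differentials are an internal differential plus a sign times one operator: the sum over
inner faces minus the sum over external faces. It acts on families F(g, e) that are alternating in
e, invariant under isomorphism, and zero when the target of g is large. The mixed terms of a squared
differential cancel because the sign flips when the degree drops by one. What remains is that the
signed sum over faces squares to zero (`faceSum_faces`).

The sum over isomorphism classes weighted by 1/|Aut| is first made concrete. A tree with n edges has
the labels 0, …, n-1 as edges, so an isomorphism class of maps out of T is a finite set of labelled
maps, with n!/|Aut| elements by orbit counting (`card_class_mul_card_aut`). Hence, in characteristic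
zero, the weighted sum is a finite sum over labelled maps with weight 1/n! (`weightedSum_eq`).

For the square, a double sum over T → X → Z is regrouped by the composite T → Z and the subtree X of
Z. The n! labellings of X, each of weight 1/n!, count the subtree once (`sum_labellings`), so only
the coefficient `pairSign` of inserting an edge c and then an edge b matters. It is symmetric in b
and c (`pairSign_comm`). Two contractions, two external faces at incomparable vertices, or one of
each at unrelated places can be done in either order. Removing two nested vertices happens in two
ways, chopping twice or contracting and then chopping, and these have opposite signs; this is why
external faces carry a minus sign. As F is antisymmetric in b and c (`Fam.raw_swap`), the sum equals
its negative and vanishes.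

Finite support and conilpotence both amount to a bound on the number of edges of targets
(`ArrowClass.finite_iff`), and such bounds pass to composites because maps of trees are injective on
edges.

For the adjunction, the unit sends y to the family (-1)^p (id, α_* y ⊗ e) and the counit sends (α, ω
⊗ e) to (-1)^p α^* ω_id(e). A face raises p by one, so with this sign the face terms of the bar and
cobar differentials cancel (`d_unitVal`, `barEval_barD`). In the triangle identities the sign occurs
twice. -/

theorem edgeMap_comp {R S T : RTree} (f : R ⟶ S) (g : S ⟶ T) (a : R.Edge) :
    edgeMap (f ≫ g) a = edgeMap g (edgeMap f a) := rfl

theorem edgeMap_bot {S T : RTree} (f : S ⟶ T) : edgeMap f ⊥ = ⊥ := RTree.Hom.map_root f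

theorem hom_ext {S T : RTree} {f g : S ⟶ T} (h : ∀ a, edgeMap f a = edgeMap g a) : f = g :=
  RTree.Hom.ext (DFunLike.ext _ _ h)

theorem card_edge (T : RTree) : Fintype.card T.Edge = T.size := Fintype.card_fin _

theorem size_le_of_hom {S T : RTree} (f : S ⟶ T) : S.size ≤ T.size := by
  simpa only [card_edge] using Fintype.card_le_of_injective _ (edgeMap f).injective

theorem size_eq_of_iso {S T : RTree} (f : S ≅ T) : S.size = T.size :=
  le_antisymm (size_le_of_hom f.hom) (size_le_of_hom f.inv)

theorem edgeMap_inv_hom {S T : RTree} (γ : S ≅ T) (a : T.Edge) :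
    edgeMap γ.hom (edgeMap γ.inv a) = a := congrArg (fun g => edgeMap g a) γ.inv_hom_id

theorem edgeMap_hom_inv {S T : RTree} (γ : S ≅ T) (a : S.Edge) :
    edgeMap γ.inv (edgeMap γ.hom a) = a := congrArg (fun g => edgeMap g a) γ.hom_inv_id

/-- The maps of trees out of `T`. -/
abbrev Out (T : RTree) : Type := Σ X : RTree, (T ⟶ X)

/-- The maps of trees into `Z`. -/
abbrev Into (Z : RTree) : Type := Σ X : RTree, (X ⟶ Z)

/-- The order on the labels is pulled back from Z along an embedding, and it determines the root; so
the bare function on labels determines both the tree and the map. -/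
theorem Into.toFun_injective (Z : RTree) : Function.Injective (fun p : Into Z =>
    (⟨p.1.size, fun a => edgeMap p.2 a⟩ : Σ n, (Label n → Z.Edge))) := by
  rintro ⟨@⟨n, o, r, hc, hr⟩, d⟩ ⟨@⟨n', o', r', hc', hr'⟩, d'⟩ h
  simp only [Sigma.mk.injEq] at h
  obtain ⟨rfl, h⟩ := h
  have h := congrFun (eq_of_heq h)
  obtain rfl : o = o' := PartialOrder.ext fun a b =>
    ((edgeMap d).le_iff_le (a := a) (b := b)).symm.trans
      ((iff_of_eq (congrArg₂ (· ≤ ·) (h a) (h b))).trans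
        ((edgeMap d').le_iff_le (a := a) (b := b)))
  obtain rfl : r = r' := Subsingleton.elim _ _
  obtain rfl : d = d' := hom_ext h
  rfl

/-- The map does not determine the order on its target, so the order is recorded too. For a bounded
number of labels only finitely many such data exist. -/
theorem Out.toFun_injective (T : RTree) : Function.Injective (fun p : Out T =>
    (⟨p.1.size, fun a b => p.1.order.le a b, fun a => edgeMap p.2 a⟩ :
      Σ n, (Label n → Label n → Prop) × (T.Edge → Label n))) := by
  rintro ⟨@⟨n, o, r, hc, hr⟩, d⟩ ⟨@⟨n', o', r', hc', hr'⟩, d'⟩ h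
  simp only [Sigma.mk.injEq] at h
  obtain ⟨rfl, h⟩ := h
  have h := Prod.ext_iff.1 (eq_of_heq h)
  obtain rfl : o = o' := PartialOrder.ext fun a b => iff_of_eq (congrFun (congrFun h.1 a) b)
  obtain rfl : r = r' := Subsingleton.elim _ _
  obtain rfl : d = d' := hom_ext (congrFun h.2)
  rfl

theorem finite_sigma_size_le {A : ℕ → Type*} [∀ n, Finite (A n)] (N : ℕ) :
    {x : Σ n, A n | x.1 ≤ N}.Finite := by
  refine (Set.finite_range fun y : Σ i : Fin (N + 1), A i => (⟨y.1, y.2⟩ : Σ n, A n)).subset ?_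
  rintro ⟨n, a⟩ h
  exact ⟨⟨⟨n, Nat.lt_succ_of_le h⟩, a⟩, rfl⟩

instance (n : ℕ) : Finite (Label n) := inferInstanceAs (Finite (Fin n))

theorem Out.finite_size_le (T : RTree) (N : ℕ) : {p : Out T | p.1.size ≤ N}.Finite :=
  ((finite_sigma_size_le N).preimage (Out.toFun_injective T).injOn).subset fun _ h => h

instance (Z : RTree) : Finite (Into Z) := by
  have : {p : Into Z | p.1.size ≤ Z.size}.Finite :=
    ((finite_sigma_size_le Z.size).preimage (Into.toFun_injective Z).injOn).subset fun _ h => h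
  rw [← Set.finite_univ_iff]
  exact this.subset fun p _ => size_le_of_hom p.2

noncomputable instance (Z : RTree) : Fintype (Into Z) := Fintype.ofFinite _

/-- The maps out of `T` to trees with at most `N` edges. -/
noncomputable def Out.upTo (T : RTree) (N : ℕ) : Finset (Out T) :=
  (Out.finite_size_le T N).toFinset

theorem Out.mem_upTo {T : RTree} {N : ℕ} {p : Out T} : p ∈ Out.upTo T N ↔ p.1.size ≤ N :=
  Set.Finite.mem_toFinset _

/-- A map into `Z` whose image contains that of `z` is a factor of `z`. -/
theorem exists_lift {T X Z : RTree} (z : T ⟶ Z) (d : X ⟶ Z)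
    (h : Set.range (edgeMap z) ⊆ Set.range (edgeMap d)) : ∃ g : T ⟶ X, g ≫ d = z := by
  choose f hf using fun a => h ⟨a, rfl⟩
  have hle : ∀ a b, f a ≤ f b ↔ a ≤ b := fun a b => by
    rw [← (edgeMap d).le_iff_le, hf, hf, (edgeMap z).le_iff_le]
  refine ⟨⟨⟨⟨f, fun a b hab => le_antisymm ((hle a b).1 hab.le) ((hle b a).1 hab.ge)⟩,
    hle _ _⟩, (edgeMap d).injective ((hf ⊥).trans ?_), fun a ha t ht hat => ?_⟩, hom_ext hf⟩
  · rw [edgeMap_bot, edgeMap_bot]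
  -- The leaf t of X need not be a leaf of Z, so it is extended to a leaf t' of Z. The edge that z
  -- provides below t' is comparable with t, and t is maximal in X.
  · obtain ⟨t', ht', hmax⟩ := (Set.toFinite {x | edgeMap d t ≤ x}).exists_le_maximal
      (a := edgeMap d t) le_rfl
    have hm : IsMax t' := fun y hy => hmax.2 (ht'.trans hy) hy
    have hat' : edgeMap z a ≤ t' := by
      rw [← hf]
      exact ((edgeMap d).le_iff_le.2 hat).trans ht'
    obtain ⟨b, hb, hbt⟩ := RTree.Hom.vertex z a ha t' hm hat'
    refine ⟨b, hb, ?_⟩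
    have hbt' : edgeMap d (f b) ≤ t' := by rw [hf]; exact hbt
    rcases Z.chain _ _ _ hbt' ht' with h1 | h1
    · exact (edgeMap d).le_iff_le.1 h1
    · exact ht ((edgeMap d).le_iff_le.1 h1)

/-- Maps of trees are injective on edges, hence monomorphisms; in particular a lift as in
`exists_lift` is unique. -/
theorem hom_cancel {T X Z : RTree} {f g : T ⟶ X} (d : X ⟶ Z) (h : f ≫ d = g ≫ d) : f = g :=
  hom_ext fun a => (edgeMap d).injective (congrArg (fun z => edgeMap z a) h)

/-- A surjective map of trees is an isomorphism. -/
theorem exists_iso_of_range {X Z : RTree} (d : X ⟶ Z) (h : Set.range (edgeMap d) = Set.univ) :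
    ∃ γ : X ≅ Z, γ.hom = d := by
  obtain ⟨g, hg⟩ := exists_lift (𝟙 Z) d (by simp [h])
  exact ⟨⟨d, g, hom_cancel d (by rw [Category.assoc, hg]; simp), hg⟩, rfl⟩

theorem range_iso {X Z : RTree} (γ : X ≅ Z) : Set.range (edgeMap γ.hom) = Set.univ :=
  Set.range_eq_univ.2 fun a => ⟨_, edgeMap_inv_hom γ a⟩

/-- The conditions for a set of edges of a tree to be the image of a map of trees. -/
structure IsSubtree {Z : RTree} (E : Set Z.Edge) : Prop where
  bot_mem : ⊥ ∈ E
  reduced : ∀ a ∈ E, (∃ x ∈ E, a < x) → ∃ b ∈ E, ∃ c ∈ E, b ≠ c ∧ a < b ∧ a < c ∧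
    (∀ x ∈ E, a < x → ¬ x < b) ∧ (∀ x ∈ E, a < x → ¬ x < c)
  vertex : ∀ a ∈ E, (∃ x ∈ E, a < x) → ∀ t, IsMax t → a ≤ t → ∃ b ∈ E, a < b ∧ b ≤ t

/-! ### Subtrees of a tree and their labellings -/

section Subtree

variable {Z : RTree} {E : Set Z.Edge} (hE : IsSubtree E) {n : ℕ} (σ : Label n ≃ E)

/-- The tree given by the set of edges `E` of `Z`, labelled by `σ`. -/
def subtree : RTree :=
  letI : PartialOrder (Label n) := PartialOrder.lift (fun a => (σ a : Z.Edge))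
    (Subtype.val_injective.comp σ.injective)
  letI : OrderBot (Label n) :=
    { bot := σ.symm ⟨⊥, hE.bot_mem⟩
      bot_le := fun a => by
        change ((σ (σ.symm ⟨⊥, hE.bot_mem⟩) : E) : Z.Edge) ≤ σ a
        rw [σ.apply_symm_apply]
        exact bot_le }
  { size := n
    chain := fun a b c hab hbc => Z.chain (σ a).1 (σ b).1 (σ c).1 hab hbc
    reduced := fun a ha => by
      obtain ⟨x, hx⟩ := not_isMax_iff.1 ha
      obtain ⟨b, hb, c, hc, hne, hab, hac, h1, h2⟩ :=
        hE.reduced (σ a) (σ a).2 ⟨σ x, (σ x).2, hx⟩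
      have hlt : ∀ (u w : Label n), u < w ↔ (σ u : Z.Edge) < σ w := fun u w => Iff.rfl
      refine ⟨σ.symm ⟨b, hb⟩, σ.symm ⟨c, hc⟩, ?_, ⟨?_, fun y hy => ?_⟩, ⟨?_, fun y hy => ?_⟩⟩
      · intro h
        exact hne (congrArg Subtype.val (σ.symm.injective h))
      · simpa [hlt] using hab
      · simpa [hlt] using h1 (σ y) (σ y).2 hy
      · simpa [hlt] using hac
      · simpa [hlt] using h2 (σ y) (σ y).2 hy }

/-- The inclusion of a subtree. -/
def subtreeHom : subtree hE σ ⟶ Z where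
  toEmb := ⟨⟨fun a => (σ a : Z.Edge), Subtype.val_injective.comp σ.injective⟩, Iff.rfl⟩
  map_root := congrArg Subtype.val (σ.apply_symm_apply ⟨⊥, hE.bot_mem⟩)
  vertex a ha t ht hat := by
    obtain ⟨x, hx⟩ := not_isMax_iff.1 ha
    obtain ⟨b, hb, hab, hbt⟩ := hE.vertex (σ a) (σ a).2 ⟨σ x, (σ x).2, hx⟩ t ht hat
    have hab' : a < (σ.symm ⟨b, hb⟩ : (subtree hE σ).Edge) := by
      change (σ a : Z.Edge) < σ (σ.symm ⟨b, hb⟩)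
      rwa [σ.apply_symm_apply]
    obtain ⟨c, hc, hcb⟩ := exists_covBy_le_of_lt hab'
    refine ⟨c, hc, le_trans (b := b) ?_ hbt⟩
    have : (σ c : Z.Edge) ≤ σ (σ.symm ⟨b, hb⟩) := hcb
    rwa [σ.apply_symm_apply] at this

theorem range_subtreeHom : Set.range (edgeMap (subtreeHom hE σ)) = E := by
  ext x
  constructor
  · rintro ⟨a, rfl⟩
    exact (σ a).2
  · intro hx
    exact ⟨σ.symm ⟨x, hx⟩, congrArg Subtype.val (σ.apply_symm_apply ⟨x, hx⟩)⟩

theorem size_of_range {X : RTree} (d : X ⟶ Z) (h : Set.range (edgeMap d) = E) :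
    X.size = E.ncard := by
  subst h
  rw [← Set.image_univ, Set.ncard_image_of_injective _ (edgeMap d).injective, Set.ncard_univ,
    Nat.card_eq_fintype_card, card_edge]

include hE in
/-- There are `n!` labelled subtrees of `Z` with a given set of `n` edges. -/
theorem card_labellings :
    Nat.card {p : Into Z // Set.range (edgeMap p.2) = E} = (E.ncard).factorial := by
  classical
  have e0 : Nonempty (Label E.ncard ≃ E) := ⟨(Finite.equivFin E).symm⟩
  have hc : Nat.card (Label E.ncard ≃ E) = (E.ncard).factorial := by
    rw [Nat.card_eq_fintype_card, Fintype.card_equiv e0.some]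
    exact congrArg _ (Fintype.card_fin _)
  rw [← hc]
  symm
  -- A labelled subtree is the same as a bijection from the labels to E, because the inclusion
  -- forces the order on the labels.
  refine Nat.card_congr (Equiv.ofBijective
    (fun σ => ⟨⟨subtree hE σ, subtreeHom hE σ⟩, range_subtreeHom hE σ⟩) ⟨?_, ?_⟩)
  · intro σ τ h
    have h := congrArg (fun p : Into Z => (⟨p.1.size, fun a => edgeMap p.2 a⟩ :
      Σ n, (Label n → Z.Edge))) (congrArg Subtype.val h)
    have h := eq_of_heq (Sigma.ext_iff.1 h).2
    exact Equiv.ext fun a => Subtype.ext (congrFun h a)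
  · rintro ⟨⟨X, d⟩, h⟩
    -- Stated for a free n, so that the equality with `E.ncard` can be substituted.
    have key : ∀ (n : ℕ) (f : Label n → Z.Edge), n = E.ncard → Function.Injective f →
        Set.range f = E → ∃ σ : Label E.ncard ≃ E,
          (⟨E.ncard, fun a => σ a⟩ : Σ n, (Label n → Z.Edge)) = ⟨n, f⟩ := by
      rintro n f rfl hf hr
      refine ⟨(Equiv.ofInjective f hf).trans (Equiv.setCongr hr), rfl⟩
    obtain ⟨σ, hσ⟩ := key X.size (fun a => edgeMap d a) (size_of_range d h)
      (edgeMap d).injective h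
    exact ⟨σ, Subtype.ext (Into.toFun_injective Z hσ)⟩

end Subtree

theorem RTree.exists_covers (T : RTree) (a : T.Edge) (ha : ¬ IsMax a) :
    ∃ b c : T.Edge, b ≠ c ∧ a ⋖ b ∧ a ⋖ c := T.reduced a ha

theorem RTree.comparable (T : RTree) (a b c : T.Edge) (ha : a ≤ c) (hb : b ≤ c) :
    a ≤ b ∨ b ≤ a := T.chain a b c ha hb

theorem isSubtree_univ (Z : RTree) : IsSubtree (Set.univ : Set Z.Edge) where
  bot_mem := trivial
  reduced a _ h := by
    obtain ⟨x, -, hx⟩ := h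
    obtain ⟨b, c, hne, hb, hc⟩ := Z.exists_covers a (not_isMax_iff.2 ⟨x, hx⟩)
    exact ⟨b, trivial, c, trivial, hne, hb.lt, hc.lt, fun x _ => hb.2 (c := x),
      fun x _ => hc.2 (c := x)⟩
  vertex a _ h t ht hat := by
    obtain ⟨x, -, hx⟩ := h
    exact ⟨t, trivial, lt_of_le_of_ne hat (by rintro rfl; exact ht.not_lt hx), le_rfl⟩

/-- Orbit counting for the relabellings of a map of trees. -/
theorem card_class_mul_card_aut {T : RTree} (U : Under T) :
    Nat.card {p : Out T // Nonempty (Under.mk p.2 ≅ U)} * Nat.card (Aut U) =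
      (U.right.size).factorial := by
  have h1 := card_labellings (isSubtree_univ U.right)
  rw [Set.ncard_univ, Nat.card_eq_fintype_card (α := U.right.Edge), card_edge] at h1
  rw [← h1, ← Nat.card_prod]
  -- A chosen isomorphism from a labelled representative to U, followed by the automorphisms of U,
  -- gives each isomorphism to U once. Forgetting T, these are the n! labellings of the tree of U;
  -- the map out of T is recovered by cancellation.
  refine Nat.card_congr (Equiv.ofBijective
    (fun x => ⟨⟨x.1.1.1, (x.1.2.some ≪≫ x.2).hom.right⟩,
      range_iso ((Under.forget T).mapIso (x.1.2.some ≪≫ x.2))⟩) ⟨?_, ?_⟩)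
  · rintro ⟨⟨⟨X, g⟩, hp⟩, a⟩ ⟨⟨⟨X', g'⟩, hp'⟩, a'⟩ h
    have h := congrArg Subtype.val h
    simp only [Sigma.mk.injEq] at h
    obtain ⟨rfl, h⟩ := h
    have h := eq_of_heq h
    have w : g ≫ (hp.some ≪≫ a).hom.right = U.hom := Under.w (hp.some ≪≫ a).hom
    have w' : g' ≫ (hp'.some ≪≫ a').hom.right = U.hom := Under.w (hp'.some ≪≫ a').hom
    rw [← h] at w'
    obtain rfl : g = g' := hom_cancel _ (w.trans w'.symm)
    have h2 : hp.some ≪≫ a = hp.some ≪≫ a' := Iso.ext (Under.UnderMorphism.ext h)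
    have h3 : a = a' := Iso.ext ((cancel_epi hp.some.hom).1 (congrArg Iso.hom h2))
    rw [h3]
  · rintro ⟨⟨X, d⟩, hd⟩
    obtain ⟨γ, rfl⟩ := exists_iso_of_range d hd
    let i : Under.mk (Y := X) (U.hom ≫ γ.inv) ≅ U := Under.isoMk γ (by simp)
    have hp : Nonempty (Under.mk (Y := X) (U.hom ≫ γ.inv) ≅ U) := ⟨i⟩
    refine ⟨⟨⟨⟨X, U.hom ≫ γ.inv⟩, hp⟩, hp.some.symm ≪≫ i⟩, Subtype.ext ?_⟩
    have : hp.some ≪≫ (hp.some.symm ≪≫ i) = i := by simp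
    change (⟨X, (hp.some ≪≫ (hp.some.symm ≪≫ i)).hom.right⟩ : Into U.right) = ⟨X, γ.hom⟩
    rw [this]
    rfl

/-! ### Weighted sums as sums over labelled trees -/

section WeightedSum

variable (k : Type u) [Field k] {V : Type v} [AddCommGroup V] [Module k V] {T : RTree}

/-- A weighted sum of an invariant function is a sum over all labelled trees. -/
theorem weightedSum_eq [CharZero k] (f : Under T → V)
    (hiso : ∀ X Y : Under T, (X ≅ Y) → f X = f Y) (N : ℕ)
    (hN : ∀ X : Under T, N < X.right.size → f X = 0) :
    weightedSum k f =
      ∑ p ∈ Out.upTo T N, ((p.1.size).factorial : k)⁻¹ • f (Under.mk p.2) := by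
  classical
  let q : Out T → ArrowClass T := fun p => arrowClass p.2
  rw [← Finset.sum_fiberwise_of_maps_to (s := Out.upTo T N) (t := (Out.upTo T N).image q) (g := q)
    (fun x hx => Finset.mem_image_of_mem q hx)]
  have hq : ∀ x : ArrowClass T, q ⟨x.out.right, x.out.hom⟩ = x := fun x => Quotient.out_eq x
  have hqi : ∀ p x, q p = x ↔ Nonempty (Under.mk p.2 ≅ x.out) := fun p x => by
    conv_lhs => rw [← Quotient.out_eq x]
    exact Quotient.eq (r := isIsomorphicSetoid (Under T))
  have hsz : ∀ p x, q p = x → p.1.size = x.out.right.size := fun p x h =>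
    ((hqi p x).1 h).elim fun i => size_eq_of_iso ((Under.forget T).mapIso i)
  unfold weightedSum
  rw [finsum_eq_sum_of_support_subset (s := (Out.upTo T N).image q)]
  · refine Finset.sum_congr rfl fun x hx => ?_
    obtain ⟨p₀, hp₀, h₀⟩ := Finset.mem_image.1 hx
    have hxN : x.out.right.size ≤ N := hsz p₀ x h₀ ▸ Out.mem_upTo.1 hp₀
    -- Isomorphic trees have equally many edges, so the cutoff N retains a class entirely or not at
    -- all.
    have hcard : ((Out.upTo T N).filter fun p => q p = x).card =
        Nat.card {p : Out T // Nonempty (Under.mk p.2 ≅ x.out)} := by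
      rw [← Nat.card_eq_finsetCard]
      refine Nat.card_congr (Equiv.subtypeEquivRight fun p => ?_)
      rw [Finset.mem_filter, hqi, Out.mem_upTo]
      exact ⟨fun h => h.2, fun h => ⟨(hsz p x ((hqi p x).2 h)).trans_le hxN, h⟩⟩
    have hmul := card_class_mul_card_aut x.out
    rw [← hcard] at hmul
    have hs : ∑ p ∈ (Out.upTo T N).filter (fun p => q p = x),
        ((p.1.size).factorial : k)⁻¹ • f (Under.mk p.2) =
        ∑ p ∈ (Out.upTo T N).filter (fun p => q p = x),
          ((x.out.right.size).factorial : k)⁻¹ • f x.out := by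
      refine Finset.sum_congr rfl fun p hp => ?_
      have hp := (Finset.mem_filter.1 hp).2
      rw [hsz p x hp, ((hqi p x).1 hp).elim fun i => hiso _ _ i]
    -- The class contributes its cardinality divided by n!, which is 1/|Aut| by orbit counting.
    -- Characteristic zero makes n!, and hence both of its factors, invertible.
    rw [hs, Finset.sum_const, ← Nat.cast_smul_eq_nsmul k, smul_smul, ← hmul]
    have hne : ((x.out.right.size).factorial : k) ≠ 0 := by
      exact_mod_cast Nat.factorial_ne_zero _
    rw [← hmul, Nat.cast_mul] at hne
    congr 1
    rw [Nat.cast_mul]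
    field_simp [left_ne_zero_of_mul hne, right_ne_zero_of_mul hne]
  · intro x hx
    have hx : f x.out ≠ 0 := fun h => hx (by simp [h])
    refine Finset.mem_coe.2 (Finset.mem_image.2 ⟨⟨x.out.right, x.out.hom⟩, ?_, hq x⟩)
    rw [Out.mem_upTo]
    by_contra h
    exact hx (hN _ (not_le.1 h))

end WeightedSum

/-! ### Faces -/

/-- Only the vertex having b as an input changes: there the inputs of b take the place of b, and
there are at least two of them. No leaf is lost since b is not a leaf. -/
theorem isSubtree_compl_singleton {Z : RTree} {b : Z.Edge} (hb : b ≠ ⊥) (hm : ¬ IsMax b) :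
    IsSubtree ({b}ᶜ : Set Z.Edge) where
  bot_mem := hb.symm
  reduced a ha h := by
    obtain ⟨x, -, hx⟩ := h
    by_cases hab : a ⋖ b
    · obtain ⟨c, d, hne, hc, hd⟩ := Z.exists_covers b hm
      have key : ∀ {c}, b ⋖ c → ∀ x ∈ ({b}ᶜ : Set Z.Edge), a < x → ¬ x < c := by
        intro c hc x hxb hax hxc
        rcases Z.comparable x b c hxc.le hc.le with h1 | h1
        · exact hab.2 hax (lt_of_le_of_ne h1 hxb)
        · exact hc.2 (lt_of_le_of_ne h1 (Ne.symm hxb)) hxc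
      exact ⟨c, hc.lt.ne', d, hd.lt.ne', hne, hab.lt.trans hc.lt, hab.lt.trans hd.lt,
        key hc, key hd⟩
    · obtain ⟨c, d, hne, hc, hd⟩ := Z.exists_covers a (not_isMax_iff.2 ⟨x, hx⟩)
      exact ⟨c, by rintro rfl; exact hab hc, d, by rintro rfl; exact hab hd, hne, hc.lt, hd.lt,
        fun x _ => hc.2 (c := x), fun x _ => hd.2 (c := x)⟩
  vertex a ha h t ht hat := by
    obtain ⟨x, -, hx⟩ := h
    exact ⟨t, by rintro rfl; exact hm ht,
      lt_of_le_of_ne hat (by rintro rfl; exact ht.not_lt hx), le_rfl⟩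

/-- An edge that still has something above it keeps all its inputs: if b lay strictly below an input
of a, it would be comparable with a, and each case contradicts the covering relation or the survival
of an edge above a. -/
theorem isSubtree_not_lt {Z : RTree} (b : Z.Edge) : IsSubtree {x : Z.Edge | ¬ b < x} := by
  have key : ∀ a : Z.Edge, ¬ b < a → (∃ x, ¬ b < x ∧ a < x) → ∀ c, a ⋖ c → ¬ b < c := by
    intro a ha ⟨x, hbx, hax⟩ c hc hbc
    rcases Z.comparable a b c hc.le hbc.le with h1 | h1
    · rcases h1.lt_or_eq with h1 | rfl
      · exact hc.2 h1 hbc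
      · exact hbx hax
    · rcases h1.lt_or_eq with h1 | rfl
      · exact ha h1
      · exact hbx hax
  refine ⟨not_lt_bot, fun a ha h => ?_, fun a ha h t ht hat => ?_⟩
  · obtain ⟨x, -, hx⟩ := id h
    obtain ⟨c, d, hne, hc, hd⟩ := Z.exists_covers a (not_isMax_iff.2 ⟨x, hx⟩)
    exact ⟨c, key a ha h c hc, d, key a ha h d hd, hne, hc.lt, hd.lt, fun x _ => hc.2 (c := x),
      fun x _ => hd.2 (c := x)⟩
  · obtain ⟨x, -, hx⟩ := id h
    obtain ⟨c, hc, hct⟩ := exists_covBy_le_of_lt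
      (lt_of_le_of_ne hat (by rintro rfl; exact ht.not_lt hx))
    exact ⟨c, key a ha h c hc, hc.lt, hct⟩

/-! ### Alternating families and the sum over all faces -/

/-- Families `F(g, e)`, for `g : T ⟶ X` and `e` an enumeration of length `q` of `X`. -/
abbrev Fam (T : RTree) (q : ℕ) (V : Type v) : Type v := ∀ X : RTree, (T ⟶ X) → Enum X q → V

namespace Fam

/-- The restriction of a family along a map of trees. -/
def precomp {T T' : RTree} {q : ℕ} {V : Type v} (F : Fam T q V) (β : T ⟶ T') : Fam T' q V :=
  fun X g e => F X (β ≫ g) e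

/-- `F(g, e) = 0` if the target of `g` has more than `N` edges. -/
def BddBy {T : RTree} {q : ℕ} {V : Type v} [AddCommGroup V] (F : Fam T q V) (N : ℕ) : Prop :=
  ∀ X g e, N < X.size → F X g e = 0

/-- Alternating and isomorphism invariant families of bounded support. -/
structure IsAlt {T : RTree} {q : ℕ} {V : Type v} [AddCommGroup V] (F : Fam T q V) : Prop where
  perm : ∀ X g e σ, F X g (e.perm σ) = Equiv.Perm.sign σ • F X g e
  iso : ∀ X X' g e (γ : X ≅ X'), F X' (g ≫ γ.hom) (e.transport γ) = F X g e
  bdd : ∃ N, F.BddBy N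

variable {k : Type u} [Field k] {V : Type v} [AddCommGroup V] [Module k V] {T : RTree} {q : ℕ}

theorem BddBy.mono {F : Fam T q V} {N N' : ℕ} (h : F.BddBy N) (hN : N ≤ N') : F.BddBy N' :=
  fun X g e hX => h X g e (hN.trans_lt hX)

theorem BddBy.precomp {F : Fam T q V} {N : ℕ} (h : F.BddBy N) {T' : RTree} (β : T ⟶ T') :
    (F.precomp β).BddBy N := fun X g e hX => h X (β ≫ g) e hX

theorem IsAlt.precomp {F : Fam T q V} (hF : F.IsAlt) {T' : RTree} (β : T ⟶ T') :
    (F.precomp β).IsAlt where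
  perm X g e σ := hF.perm X (β ≫ g) e σ
  iso X X' g e γ := hF.iso X X' (β ≫ g) e γ
  bdd := hF.bdd.imp fun _ h => h.precomp β

theorem IsAlt.map {W : Type*} [AddCommGroup W] {F : Fam T q V} (hF : F.IsAlt) (φ : V →+ W) :
    Fam.IsAlt (fun X g e => φ (F X g e)) where
  perm X g e σ := by rw [hF.perm, Units.smul_def, Units.smul_def, map_zsmul]
  iso X X' g e γ := by rw [hF.iso]
  bdd := hF.bdd.imp fun _ h X g e hX => by
    change φ (F X g e) = 0
    rw [h X g e hX, map_zero]

open Classical in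
/-- The extension of a family by zero to all sequences of edges. -/
noncomputable def raw (F : Fam T q V) (X : RTree) (g : T ⟶ X) (ε : Fin q → X.Edge) : V :=
  if h : Function.Injective ε ∧ ∀ x, ¬ IsMax x ↔ ∃ i, ε i = x then F X g ⟨ε, h.1, h.2⟩ else 0

theorem raw_edge (F : Fam T q V) (X : RTree) (g : T ⟶ X) (e : Enum X q) :
    F.raw X g e.edge = F X g e := dif_pos ⟨e.injective, e.mem_iff⟩

theorem raw_cases (F : Fam T q V) (X : RTree) (ε : Fin q → X.Edge) :
    (∃ e : Enum X q, e.edge = ε) ∨ ∀ g, F.raw X g ε = 0 := by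
  by_cases h : Function.Injective ε ∧ ∀ x, ¬ IsMax x ↔ ∃ i, ε i = x
  · exact Or.inl ⟨⟨ε, h.1, h.2⟩, rfl⟩
  · exact Or.inr fun g => dif_neg h

/-- A sequence of edges and its permutations are enumerations simultaneously, so extending by zero
keeps the family alternating. -/
theorem raw_comp_perm {F : Fam T q V} (hF : F.IsAlt) (X : RTree) (g : T ⟶ X)
    (ε : Fin q → X.Edge) (σ : Equiv.Perm (Fin q)) :
    F.raw X g (ε ∘ σ) = Equiv.Perm.sign σ • F.raw X g ε := by
  rcases F.raw_cases X ε with ⟨e, rfl⟩ | h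
  · rw [raw_edge, ← hF.perm]
    exact F.raw_edge X g (e.perm σ)
  · rcases F.raw_cases X (ε ∘ σ) with ⟨e, he⟩ | h'
    · have : (e.perm σ⁻¹).edge = ε := by
        change e.edge ∘ _ = _
        rw [he]
        ext i
        simp
      have h2 := h g
      rw [← this, raw_edge, hF.perm, smul_eq_zero_iff_eq] at h2
      rw [← he, raw_edge, h g, smul_zero, h2]
    · rw [h, h', smul_zero]

theorem raw_transport {F : Fam T q V} (hF : F.IsAlt) {X X' : RTree} (g : T ⟶ X)
    (ε : Fin q → X.Edge) (γ : X ≅ X') :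
    F.raw X' (g ≫ γ.hom) (edgeMap γ.hom ∘ ε) = F.raw X g ε := by
  rcases F.raw_cases X ε with ⟨e, rfl⟩ | h
  · rw [raw_edge, ← hF.iso X X' g e γ]
    exact F.raw_edge X' _ (e.transport γ)
  · rcases F.raw_cases X' (edgeMap γ.hom ∘ ε) with ⟨e, he⟩ | h'
    · have : (e.transport γ.symm).edge = ε := by
        change edgeMap γ.inv ∘ e.edge = _
        rw [he]
        ext i
        exact edgeMap_hom_inv γ _
      have h2 := hF.iso X' X (g ≫ γ.hom) e γ.symm
      rw [← F.raw_edge X, this, h] at h2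
      rw [← he, raw_edge, h g, ← h2]
    · rw [h, h']

theorem raw_eq_zero_of_bddBy {F : Fam T q V} {N : ℕ} (h : F.BddBy N) {X : RTree} (g : T ⟶ X)
    (ε : Fin q → X.Edge) (hX : N < X.size) : F.raw X g ε = 0 := by
  rcases F.raw_cases X ε with ⟨e, rfl⟩ | h'
  · rw [raw_edge, h X g e hX]
  · exact h' g

theorem raw_precomp (F : Fam T q V) {T' : RTree} (β : T ⟶ T') (X : RTree) (g : T' ⟶ X)
    (ε : Fin q → X.Edge) : (F.precomp β).raw X g ε = F.raw X (β ≫ g) ε := rfl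

end Fam

open Classical in
/-- The sign of a face: `1` for an inner face, `-1` for an external face, `0` for other maps. -/
noncomputable def faceSign (k : Type u) [Field k] {T X : RTree} (d : T ⟶ X) (b : X.Edge) : k :=
  (if IsInnerFace d b then 1 else 0) - (if IsTopFace d b then 1 else 0)

/-! ### The signed sum over faces, computed on labelled trees -/

section FaceSum

variable (k : Type u) [Field k] {V : Type v} [AddCommGroup V] [Module k V] {T : RTree} {p : ℕ}

/-- `∫_d F(d, de)`, where `d` runs over the inner faces. -/
noncomputable def innerFaceSum (F : Fam T (p + 1) V) (e : Enum T p) : V :=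
  weightedSum k fun X : Under T =>
    ∑ᶠ (b : X.right.Edge) (h : IsInnerFace (T := T) (T' := X.right) X.hom b),
      F X.right X.hom (e.cons X.hom b h.isNewEdge)

/-- `∫_v F(v, de)`, where `v` runs over the external faces. -/
noncomputable def topFaceSum (F : Fam T (p + 1) V) (e : Enum T p) : V :=
  weightedSum k fun X : Under T =>
    ∑ᶠ (b : X.right.Edge) (h : IsTopFace (T := T) (T' := X.right) X.hom b),
      F X.right X.hom (e.cons X.hom b h.isNewEdge)

/-- `∫_d F(d, de) - ∫_v F(v, de)`, where `d` runs over the inner and `v` over the external faces. -/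
noncomputable def faceSum (F : Fam T (p + 1) V) (e : Enum T p) : V :=
  innerFaceSum k F e - topFaceSum k F e

theorem isInnerFace_comp_iso {T X X' : RTree} {d : T ⟶ X} {b : X.Edge} (γ : X ≅ X')
    (h : IsInnerFace d b) : IsInnerFace (d ≫ γ.hom) (edgeMap γ.hom b) := by
  obtain ⟨h1, h2, h3⟩ := h
  refine ⟨fun h => h1 ((edgeMap γ.hom).injective (h.trans (edgeMap_bot _).symm)),
    (isMax_iso_iff γ b).not.2 h2, Set.ext fun x => ?_⟩
  have := Set.ext_iff.1 h3 (edgeMap γ.inv x)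
  simp only [Set.mem_range, Set.mem_ofPred_eq] at this ⊢
  rw [← edgeMap_inv_hom γ x, (edgeMap γ.hom).injective.ne_iff, ← this]
  simp only [edgeMap_comp, (edgeMap γ.hom).injective.eq_iff]

theorem isTopFace_comp_iso {T X X' : RTree} {d : T ⟶ X} {b : X.Edge} (γ : X ≅ X')
    (h : IsTopFace d b) : IsTopFace (d ≫ γ.hom) (edgeMap γ.hom b) := by
  obtain ⟨h1, h2, h3⟩ := h
  refine ⟨(isMax_iso_iff γ b).not.2 h1, fun x hx => ?_, Set.ext fun x => ?_⟩
  · rw [← edgeMap_inv_hom γ x] at hx ⊢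
    rw [isMax_iso_iff]
    exact h2 _ ((edgeMap γ.hom).lt_iff_lt.1 hx)
  have := Set.ext_iff.1 h3 (edgeMap γ.inv x)
  simp only [Set.mem_range, Set.mem_ofPred_eq] at this ⊢
  rw [← edgeMap_inv_hom γ x, (edgeMap γ.hom).lt_iff_lt, ← this]
  simp only [edgeMap_comp, (edgeMap γ.hom).injective.eq_iff]

open Classical in
/-- A weighted sum over faces of a given kind as a sum over labelled trees. -/
theorem weightedSum_face_eq [CharZero k] (P : ∀ X : RTree, (T ⟶ X) → X.Edge → Prop)
    (hP : ∀ X d b, P X d b → IsNewEdge d b)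
    (hiso : ∀ X X' d b (γ : X ≅ X'), P X d b → P X' (d ≫ γ.hom) (edgeMap γ.hom b))
    {F : Fam T (p + 1) V} (hF : F.IsAlt) {N : ℕ} (hN : F.BddBy N) (e : Enum T p) :
    weightedSum k (fun X : Under T => ∑ᶠ (b : X.right.Edge) (h : P X.right X.hom b),
      F X.right X.hom (e.cons X.hom b (hP _ _ _ h))) =
    ∑ x ∈ Out.upTo T N, ((x.1.size).factorial : k)⁻¹ •
      ∑ b : x.1.Edge, (if P x.1 x.2 b then (1 : k) else 0) •
        F.raw x.1 x.2 (Fin.cons b (edgeMap x.2 ∘ e.edge)) := by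
  have h1 : ∀ X : Under T, (∑ᶠ (b : X.right.Edge) (h : P X.right X.hom b),
      F X.right X.hom (e.cons X.hom b (hP _ _ _ h))) =
      ∑ b : X.right.Edge, (if P X.right X.hom b then (1 : k) else 0) •
        F.raw X.right X.hom (Fin.cons b (edgeMap (T := X.right) X.hom ∘ e.edge)) := by
    intro X
    rw [finsum_eq_sum_of_fintype]
    refine Finset.sum_congr rfl fun b _ => ?_
    rw [finsum_eq_dif]
    split_ifs with h
    · rw [one_smul]
      exact (F.raw_edge X.right X.hom (e.cons X.hom b (hP _ _ _ h))).symm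
    · rw [zero_smul]
  rw [weightedSum_eq k _ ?_ N ?_]
  · exact Finset.sum_congr rfl fun x _ => by rw [h1]; rfl
  · intro X Y i
    rw [h1, h1]
    let γ : X.right ≅ Y.right := (Under.forget T).mapIso i
    have hγ : Y.hom = X.hom ≫ γ.hom := (Under.w i.hom).symm
    have hγ' : X.hom = Y.hom ≫ γ.inv := (Under.w i.inv).symm
    -- An isomorphism under T carries new edges to new edges of the same kind, so it reindexes the
    -- sum over b.
    refine Fintype.sum_bijective (edgeMap γ.hom)
      ⟨(edgeMap γ.hom).injective, Set.range_eq_univ.1 (range_iso γ)⟩ _ _ fun b => ?_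
    have hiff : P X.right X.hom b ↔ P Y.right Y.hom (edgeMap γ.hom b) := by
      constructor
      · rw [hγ]
        exact hiso _ _ _ _ γ
      · intro h
        have := hiso _ _ _ _ γ.symm h
        rw [Iso.symm_hom, edgeMap_hom_inv] at this
        rwa [hγ']
    rw [if_congr hiff rfl rfl, ← Fam.raw_transport hF _ _ γ]
    congr 1
    have : (Fin.cons (edgeMap γ.hom b) (edgeMap (T := Y.right) Y.hom ∘ e.edge) :
        Fin (p + 1) → Y.right.Edge) =
        edgeMap γ.hom ∘ Fin.cons b (edgeMap (T := X.right) X.hom ∘ e.edge) := by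
      rw [hγ]
      funext i
      exact Fin.cases rfl (fun j => rfl) i
    rw [this, hγ]
  · intro X hX
    rw [h1]
    exact Finset.sum_eq_zero fun b _ => by rw [Fam.raw_eq_zero_of_bddBy hN _ _ hX, smul_zero]

/-- The working form of the face sum. With `faceSign` as coefficient and F extended by zero, b runs
over all edges and no term depends on a proof that b is new. Any bound N for the support may be
used, so different families can share one index set. -/
theorem faceSum_eq [CharZero k] {F : Fam T (p + 1) V} (hF : F.IsAlt) {N : ℕ} (hN : F.BddBy N)
    (e : Enum T p) :
    faceSum k F e = ∑ x ∈ Out.upTo T N, ((x.1.size).factorial : k)⁻¹ •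
      ∑ b : x.1.Edge, faceSign k x.2 b •
        F.raw x.1 x.2 (Fin.cons b (edgeMap x.2 ∘ e.edge)) := by
  have h1 := weightedSum_face_eq k (fun X d b => IsInnerFace d b) (fun _ _ _ h => h.isNewEdge)
    (fun _ _ _ _ γ h => isInnerFace_comp_iso γ h) hF hN e
  have h2 := weightedSum_face_eq k (fun X d b => IsTopFace d b) (fun _ _ _ h => h.isNewEdge)
    (fun _ _ _ _ γ h => isTopFace_comp_iso γ h) hF hN e
  refine (congrArg₂ (· - ·) h1 h2).trans ?_
  rw [← Finset.sum_sub_distrib]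
  refine Finset.sum_congr rfl fun x _ => ?_
  rw [← smul_sub, ← Finset.sum_sub_distrib]
  simp only [faceSign, sub_smul]

end FaceSum

/-! ### Linearity and invariance of the signed sum over faces -/

section FaceSum

variable {k : Type u} [Field k] [CharZero k] {V : Type v} [AddCommGroup V] [Module k V]
  {T : RTree} {p : ℕ}

/-- The face sum is a finite linear combination of values of F. This is what moves restriction maps
and internal differentials through it. -/
theorem map_faceSum {W : Type v} [AddCommGroup W] [Module k W] (φ : V →ₗ[k] W)
    {F : Fam T (p + 1) V} (hF : F.IsAlt) (e : Enum T p) :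
    φ (faceSum k F e) = faceSum k (fun X g e => φ (F X g e)) e := by
  obtain ⟨N, hN⟩ := hF.bdd
  have hN' : Fam.BddBy (fun X g e => φ (F X g e)) N := fun X g e hX => by
    change φ (F X g e) = 0
    rw [hN X g e hX, map_zero]
  rw [faceSum_eq k hF hN, faceSum_eq k (F := fun X g e => φ (F X g e))
    (hF.map φ.toAddMonoidHom) hN', map_sum]
  refine Finset.sum_congr rfl fun x _ => ?_
  rw [map_smul, map_sum]
  congr 1
  refine Finset.sum_congr rfl fun b _ => ?_
  rw [map_smul]
  congr 1
  unfold Fam.raw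
  split_ifs
  · rfl
  · exact map_zero φ

theorem faceSum_add {F G : Fam T (p + 1) V} (hF : F.IsAlt) (hG : G.IsAlt) (e : Enum T p) :
    faceSum k (F + G) e = faceSum k F e + faceSum k G e := by
  obtain ⟨N, hN⟩ := hF.bdd
  obtain ⟨N', hN'⟩ := hG.bdd
  have h1 := hN.mono (le_max_left N N')
  have h2 := hN'.mono (le_max_right N N')
  have h3 : (F + G).BddBy (max N N') := fun X g e hX => by
    change F X g e + G X g e = 0
    rw [h1 X g e hX, h2 X g e hX, add_zero]
  have hFG : (F + G).IsAlt := ⟨fun X g e σ => by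
      change F X g _ + G X g _ = _ • (F X g e + G X g e)
      rw [hF.perm, hG.perm, smul_add], fun X X' g e γ => by
      change F X' _ _ + G X' _ _ = F X g e + G X g e
      rw [hF.iso, hG.iso], _, h3⟩
  rw [faceSum_eq k hF h1, faceSum_eq k hG h2, faceSum_eq k hFG h3, ← Finset.sum_add_distrib]
  refine Finset.sum_congr rfl fun x _ => ?_
  rw [← smul_add, ← Finset.sum_add_distrib]
  congr 1
  refine Finset.sum_congr rfl fun b _ => ?_
  rw [← smul_add]
  congr 1
  unfold Fam.raw
  split_ifs
  · rfl
  · exact (add_zero 0).symm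

theorem faceSum_smul (r : k) {F : Fam T (p + 1) V} (hF : F.IsAlt) (e : Enum T p) :
    faceSum k (r • F) e = r • faceSum k F e :=
  (map_faceSum (LinearMap.lsmul k V r) hF e).symm

theorem faceSum_negOnePow_smul (n : ℤ) {F : Fam T (p + 1) V} (hF : F.IsAlt) (e : Enum T p) :
    faceSum k (fun X g e => n.negOnePow • F X g e) e = n.negOnePow • faceSum k F e := by
  have h := faceSum_smul (k := k) ((n.negOnePow : ℤ) : k) hF e
  rw [Int.cast_smul_eq_zsmul k _ (faceSum k F e)] at h
  rw [Units.smul_def, ← h]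
  congr 1
  funext X g e
  exact (Int.cast_smul_eq_zsmul k _ _).symm

theorem faceSum_perm {F : Fam T (p + 1) V} (hF : F.IsAlt) (e : Enum T p)
    (σ : Equiv.Perm (Fin p)) :
    faceSum k F (e.perm σ) = Equiv.Perm.sign σ • faceSum k F e := by
  obtain ⟨N, hN⟩ := hF.bdd
  rw [faceSum_eq k hF hN, faceSum_eq k hF hN, Units.smul_def, Finset.smul_sum]
  refine Finset.sum_congr rfl fun x _ => ?_
  rw [smul_comm _ (_ : k)]
  congr 1
  rw [Finset.smul_sum]
  refine Finset.sum_congr rfl fun b _ => ?_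
  rw [smul_comm _ (_ : k), ← Units.smul_def]
  congr 1
  -- The permutation coming from (0, σ) fixes the position of the new edge and acts as σ on the
  -- others, so its sign is that of σ.
  have h : (Fin.cons b (edgeMap x.2 ∘ (e.perm σ).edge) : Fin (p + 1) → x.1.Edge) =
      Fin.cons b (edgeMap x.2 ∘ e.edge) ∘ Equiv.Perm.decomposeFin.symm (0, σ) := by
    funext i
    refine Fin.cases ?_ (fun j => ?_) i
    · simp
    · simp [Enum.perm]
  rw [h, Fam.raw_comp_perm hF, Equiv.Perm.decomposeFin.symm_sign, if_pos rfl, one_mul]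

/-- Precomposition with γ permutes the labelled maps, and being a face depends only on the image in
the target. -/
theorem faceSum_iso {F : Fam T (p + 1) V} (hF : F.IsAlt) (e : Enum T p) {T' : RTree}
    (γ : T ≅ T') : faceSum k (F.precomp γ.hom) (e.transport γ) = faceSum k F e := by
  obtain ⟨N, hN⟩ := hF.bdd
  rw [faceSum_eq k hF hN, faceSum_eq k (hF.precomp γ.hom) (hN.precomp γ.hom)]
  refine Finset.sum_bij' (fun x _ => ⟨x.1, γ.hom ≫ x.2⟩) (fun x _ => ⟨x.1, γ.inv ≫ x.2⟩)
    (fun x hx => Out.mem_upTo.2 (Out.mem_upTo (p := x).1 hx))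
    (fun x hx => Out.mem_upTo.2 (Out.mem_upTo (p := x).1 hx)) (fun x _ => by simp) (fun x _ => by simp)
    fun x _ => ?_
  congr 1
  refine Finset.sum_congr rfl fun b _ => ?_
  have hr : Set.range (edgeMap x.2) = Set.range (edgeMap (γ.hom ≫ x.2)) := by
    ext y
    constructor
    · rintro ⟨a, rfl⟩
      exact ⟨edgeMap γ.inv a, congrArg (edgeMap x.2) (edgeMap_inv_hom γ a)⟩
    · rintro ⟨a, rfl⟩
      exact ⟨edgeMap γ.hom a, rfl⟩
  unfold faceSign IsInnerFace IsTopFace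
  rw [hr]
  rfl

variable (k) in
/-- The family of the sums over all faces of the target. -/
noncomputable def Fam.faces (F : Fam T (p + 1) V) : Fam T p V :=
  fun _ g e => faceSum k (F.precomp g) e

/-- Maps out of a tree with more than N edges end in trees with more than N edges. -/
theorem Fam.BddBy.faces {F : Fam T (p + 1) V} {N : ℕ} (hF : F.IsAlt) (hN : F.BddBy N) :
    (F.faces k).BddBy N := fun _ g e hX => by
  refine (faceSum_eq k (hF.precomp g) (hN.precomp g) e).trans
    (Finset.sum_eq_zero fun x hx => ?_)
  exact absurd (Out.mem_upTo.1 hx) (not_le.2 (hX.trans_le (size_le_of_hom x.2)))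

theorem Fam.IsAlt.faces {F : Fam T (p + 1) V} (hF : F.IsAlt) : (F.faces k).IsAlt where
  perm _ g e σ := faceSum_perm (hF.precomp g) e σ
  iso _ _ g e γ := faceSum_iso (hF.precomp g) e γ
  bdd := hF.bdd.imp fun _ h => h.faces hF

end FaceSum

/-! ### The square of the sum over faces -/

section RelFace

variable {Z : RTree}

/-- In the subtree of `Z` with edges `E`, contraction of the inner edge `c` gives `I`. -/
def RelInner (E I : Set Z.Edge) (c : Z.Edge) : Prop :=
  c ∈ E ∧ c ≠ ⊥ ∧ (∃ x ∈ E, c < x) ∧ I = {x | x ∈ E ∧ x ≠ c}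

/-- In the subtree of `Z` with edges `E`, chopping off the top vertex with output `c` gives `I`. -/
def RelTop (E I : Set Z.Edge) (c : Z.Edge) : Prop :=
  c ∈ E ∧ (∃ x ∈ E, c < x) ∧ (∀ x ∈ E, c < x → ∀ y ∈ E, ¬ x < y) ∧ I = {x | x ∈ E ∧ ¬ c < x}

/-- For a composite T → X → Z this turns conditions on edges of X into conditions on edges of Z, so
that both faces can be compared inside the one tree Z. -/
theorem range_comp_eq_iff {T X : RTree} (d : T ⟶ X) (q : X ⟶ Z) (A : Set X.Edge) (B : Set Z.Edge)
    (h : ∀ a, a ∈ A ↔ edgeMap q a ∈ B) :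
    Set.range (edgeMap d) = A ↔
      Set.range (edgeMap (d ≫ q)) = {x | x ∈ Set.range (edgeMap q) ∧ x ∈ B} := by
  constructor
  · rintro rfl
    ext x
    constructor
    · rintro ⟨a, rfl⟩
      exact ⟨⟨_, rfl⟩, (h _).1 ⟨a, rfl⟩⟩
    · rintro ⟨⟨a, rfl⟩, ha⟩
      obtain ⟨b, rfl⟩ := (h a).2 ha
      exact ⟨b, rfl⟩
  · intro h'
    ext x
    rw [h x]
    have := Set.ext_iff.1 h' (edgeMap q x)
    constructor
    · rintro ⟨a, rfl⟩
      exact (this.1 ⟨a, rfl⟩).2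
    · intro hx
      obtain ⟨a, ha⟩ := this.2 ⟨⟨_, rfl⟩, hx⟩
      exact ⟨a, (edgeMap q).injective ha⟩

theorem isInnerFace_iff_relInner {T X : RTree} (d : T ⟶ X) (q : X ⟶ Z) (b : X.Edge) :
    IsInnerFace d b ↔
      RelInner (Set.range (edgeMap q)) (Set.range (edgeMap (d ≫ q))) (edgeMap q b) := by
  unfold IsInnerFace RelInner
  rw [range_comp_eq_iff d q {x | x ≠ b} {x | x ≠ edgeMap q b}
    (fun a => (edgeMap q).injective.ne_iff.symm)]
  have h1 : edgeMap q b ≠ ⊥ ↔ b ≠ ⊥ := by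
    rw [← edgeMap_bot q, (edgeMap q).injective.ne_iff]
  simp [h1, not_isMax_iff]

theorem isTopFace_iff_relTop {T X : RTree} (d : T ⟶ X) (q : X ⟶ Z) (b : X.Edge) :
    IsTopFace d b ↔
      RelTop (Set.range (edgeMap q)) (Set.range (edgeMap (d ≫ q))) (edgeMap q b) := by
  unfold IsTopFace RelTop
  rw [range_comp_eq_iff d q {x | ¬ b < x} {x | ¬ edgeMap q b < x}
    (fun a => (edgeMap q).lt_iff_lt.not.symm)]
  simp [isMax_iff_forall_not_lt]

theorem isInnerFace_iff {X : RTree} (d : X ⟶ Z) (b : Z.Edge) :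
    IsInnerFace d b ↔ (b ≠ ⊥ ∧ ¬ IsMax b) ∧ Set.range (edgeMap d) = {b}ᶜ :=
  and_assoc.symm

/-- `b` is the output of a top vertex. -/
def IsTop (b : Z.Edge) : Prop := ¬ IsMax b ∧ ∀ x, b < x → IsMax x

theorem isTopFace_iff {X : RTree} (d : X ⟶ Z) (b : Z.Edge) :
    IsTopFace d b ↔ IsTop b ∧ Set.range (edgeMap d) = {x | ¬ b < x} :=
  and_assoc.symm

/-- Contraction of `b` after chopping off the top vertex with output `c`, for `c` not below `b`. -/
def RelDisjoint (I : Set Z.Edge) (b c : Z.Edge) : Prop :=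
  b ≠ ⊥ ∧ ¬ IsMax b ∧ b ≠ c ∧ ¬ c < b ∧ IsTop c ∧ I = {x | x ≠ b ∧ ¬ c < x}

/-- Chopping off two vertices, that with output `b` sitting on top of that with output `c`. -/
def RelNested (I : Set Z.Edge) (b c : Z.Edge) : Prop :=
  IsTop b ∧ c < b ∧ (∀ x, c < x → x = b ∨ IsMax x) ∧ I = {x | ¬ c < x}

/-- Contraction of two edges. -/
def RelContract (I : Set Z.Edge) (b c : Z.Edge) : Prop :=
  b ≠ c ∧ b ≠ ⊥ ∧ c ≠ ⊥ ∧ ¬ IsMax b ∧ ¬ IsMax c ∧ I = {x | x ≠ b ∧ x ≠ c}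

/-- Chopping off two incomparable vertices. -/
def RelChop (I : Set Z.Edge) (b c : Z.Edge) : Prop :=
  b ≠ c ∧ ¬ b < c ∧ ¬ c < b ∧ IsTop b ∧ IsTop c ∧ I = {x | ¬ b < x ∧ ¬ c < x}

theorem inner_inner_iff (I : Set Z.Edge) (b c : Z.Edge) :
    (b ≠ ⊥ ∧ ¬ IsMax b) ∧ RelInner {b}ᶜ I c ↔ RelContract I b c := by
  constructor
  · rintro ⟨⟨h1, h2⟩, h3, h4, ⟨x, -, hx⟩, h6⟩
    exact ⟨Ne.symm h3, h1, h4, h2, not_isMax_iff.2 ⟨x, hx⟩, h6⟩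
  · rintro ⟨h1, h2, h3, h4, h5, h6⟩
    refine ⟨⟨h2, h4⟩, Ne.symm h1, h3, ?_, h6⟩
    obtain ⟨x, hx⟩ := not_isMax_iff.1 h5
    -- If the edge found above c is the contracted edge b itself, an edge above b replaces it.
    by_cases hxb : x = b
    · subst hxb
      obtain ⟨y, hy⟩ := not_isMax_iff.1 h4
      exact ⟨y, hy.ne', hx.trans hy⟩
    · exact ⟨x, hxb, hx⟩

/-- After contraction of b, the vertex above c is on top either because it was already and b is not
above c, or because b was its only input that is not a leaf and the vertex above b was on top. In
the second case two nested vertices of Z disappear. -/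
theorem inner_top_iff (I : Set Z.Edge) (b c : Z.Edge) :
    (b ≠ ⊥ ∧ ¬ IsMax b) ∧ RelTop {b}ᶜ I c ↔ RelDisjoint I b c ∨ RelNested I b c := by
  constructor
  · rintro ⟨⟨h1, h2⟩, h3, ⟨x, hx, hcx⟩, h5, rfl⟩
    have hmax : ∀ x, x ≠ b → c < x → ¬ x < b → IsMax x := by
      intro x hx hcx hxb
      rw [isMax_iff_forall_not_lt]
      intro y hy
      by_cases hyb : y = b
      · exact hxb (hyb ▸ hy)
      · exact h5 x hx hcx y hyb hy
    have hxb' : ∀ x, c < x → ¬ x < b := by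
      intro x hcx hxb
      obtain ⟨y, hy⟩ := not_isMax_iff.1 h2
      exact h5 x hxb.ne hcx y hy.ne' (hxb.trans hy)
    by_cases hcb : c < b
    · right
      refine ⟨⟨h2, fun x hx => hmax x hx.ne' (hcb.trans hx) hx.not_gt⟩, hcb, fun x hx => ?_, ?_⟩
      · by_cases hxb : x = b
        · exact Or.inl hxb
        · exact Or.inr (hmax x hxb hx (hxb' x hx))
      · ext x
        exact ⟨fun h => h.2, fun h => ⟨fun hb => h (hb ▸ hcb), h⟩⟩
    · left
      exact ⟨h1, h2, Ne.symm h3, hcb, ⟨not_isMax_iff.2 ⟨x, hcx⟩, fun x hx =>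
        hmax x (fun h => hcb (h ▸ hx)) hx (hxb' x hx)⟩, rfl⟩
  · rintro (⟨h1, h2, h3, h4, ⟨h5, h6⟩, h7⟩ | ⟨⟨h1, h2⟩, h3, h4, rfl⟩)
    · obtain ⟨x, hx⟩ := not_isMax_iff.1 h5
      exact ⟨⟨h1, h2⟩, Ne.symm h3, ⟨x, fun h => h4 (h ▸ hx), hx⟩,
        fun x _ hx y _ hy => (h6 x hx).not_lt hy, h7⟩
    · obtain ⟨x, hx⟩ := not_isMax_iff.1 h1
      refine ⟨⟨(bot_le.trans_lt h3).ne', h1⟩, h3.ne, ⟨x, hx.ne', h3.trans hx⟩,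
        fun x hxb hx y _ hy => ?_, ?_⟩
      · rcases h4 x hx with h | h
        · exact hxb h
        · exact h.not_lt hy
      · ext x
        exact ⟨fun h => ⟨fun hb => h (hb ▸ h3), h⟩, fun h => h.2⟩

theorem top_inner_iff (I : Set Z.Edge) (b c : Z.Edge) :
    IsTop b ∧ RelInner {x | ¬ b < x} I c ↔ RelDisjoint I c b := by
  constructor
  · rintro ⟨h1, h3, h4, ⟨x, hx, hcx⟩, h6⟩
    refine ⟨h4, not_isMax_iff.2 ⟨x, hcx⟩, fun h => hx (h ▸ hcx), h3, h1, h6.trans ?_⟩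
    ext x
    exact and_comm
  · rintro ⟨h1, h2, h3, h4, h5, h6⟩
    refine ⟨h5, h4, h1, ?_, h6.trans ?_⟩
    · obtain ⟨x, hx⟩ := not_isMax_iff.1 h2
      by_cases hbx : b < x
      · refine ⟨b, lt_irrefl b, lt_of_le_of_ne ?_ h3⟩
        rcases Z.comparable c b x hx.le hbx.le with h | h
        · exact h
        · exact absurd (lt_of_le_of_ne h (Ne.symm h3)) h4
      · exact ⟨x, hbx, hx⟩
    · ext x
      exact and_comm

/-- After chopping at b, the vertex above c is on top either because it was before, or because b was
its only input that is not a leaf. The nested case is literally the one in `inner_top_iff`, which is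
what makes the two cancel. -/
theorem top_top_iff (I : Set Z.Edge) (b c : Z.Edge) :
    IsTop b ∧ RelTop {x | ¬ b < x} I c ↔ RelChop I b c ∨ RelNested I b c := by
  constructor
  · rintro ⟨⟨h1, h2⟩, h3, ⟨x, hx, hcx⟩, h5, rfl⟩
    have hne : b ≠ c := fun h => hx (h ▸ hcx)
    have key : ∀ x, ¬ b < x → c < x → x ≠ b → IsMax x := by
      intro x hbx hcx hxb
      rw [isMax_iff_forall_not_lt]
      intro y hxy
      by_cases hby : b < y
      · rcases Z.comparable x b y hxy.le hby.le with h | h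
        · exact h5 x hbx hcx b (lt_irrefl b) (lt_of_le_of_ne h hxb)
        · exact hbx (lt_of_le_of_ne h (Ne.symm hxb))
      · exact h5 x hbx hcx y hby hxy
    by_cases hcb : c < b
    · right
      refine ⟨⟨h1, h2⟩, hcb, fun x hx => ?_, ?_⟩
      · by_cases hxb : x = b
        · exact Or.inl hxb
        · by_cases hbx : b < x
          · exact Or.inr (h2 x hbx)
          · exact Or.inr (key x hbx hx hxb)
      · ext x
        exact ⟨fun h => h.2, fun h => ⟨fun hb => h (hcb.trans hb), h⟩⟩
    · left
      refine ⟨hne, h3, hcb, ⟨h1, h2⟩, ⟨not_isMax_iff.2 ⟨x, hcx⟩, fun x hx => ?_⟩, rfl⟩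
      by_cases hbx : b < x
      · exact h2 x hbx
      · exact key x hbx hx (fun h => hcb (h ▸ hx))
  · rintro (⟨h1, h2, h3, h4, ⟨h5, h6⟩, h7⟩ | ⟨h1, h3, h4, rfl⟩)
    · obtain ⟨x, hx⟩ := not_isMax_iff.1 h5
      refine ⟨h4, h2, ⟨x, fun hbx => ?_, hx⟩, fun x _ hx y _ hy => (h6 x hx).not_lt hy, h7⟩
      rcases Z.comparable b c x hbx.le hx.le with h | h
      · exact h2 (lt_of_le_of_ne h h1)
      · exact h3 (lt_of_le_of_ne h (Ne.symm h1))
    · refine ⟨h1, h3.not_gt, ⟨b, lt_irrefl b, h3⟩, fun x hbx hx y hy hxy => ?_, ?_⟩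
      · rcases h4 x hx with rfl | h
        · exact hy hxy
        · exact h.not_lt hxy
      · ext x
        exact ⟨fun h => ⟨fun hb => h (h3.trans hb), h⟩, fun h => h.2⟩

variable (k : Type u) [Field k]

open Classical in
/-- The sign of a face of the subtree of `Z` with edges `E`. -/
noncomputable def relSign (E I : Set Z.Edge) (c : Z.Edge) : k :=
  (if RelInner E I c then 1 else 0) - (if RelTop E I c then 1 else 0)

theorem faceSign_eq_relSign {T X : RTree} (d : T ⟶ X) (q : X ⟶ Z) (b : X.Edge) :
    faceSign k d b =
      relSign k (Set.range (edgeMap q)) (Set.range (edgeMap (d ≫ q))) (edgeMap q b) := by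
  classical
  exact congrArg₂ (· - ·) (if_congr (isInnerFace_iff_relInner d q b) rfl rfl)
    (if_congr (isTopFace_iff_relTop d q b) rfl rfl)

/-- Used twice: pairs without a factorization contribute zero, and a sum over the edges of a subtree
extends to all edges of Z. -/
theorem relSign_eq_zero {E I : Set Z.Edge} {c : Z.Edge} (h : ¬ (c ∈ E ∧ I ⊆ E)) :
    relSign k E I c = 0 := by
  unfold relSign
  rw [if_neg, if_neg, sub_zero]
  · rintro ⟨h1, -, -, rfl⟩
    exact h ⟨h1, fun x hx => hx.1⟩
  · rintro ⟨h1, -, -, rfl⟩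
    exact h ⟨h1, fun x hx => hx.1⟩

/-- The total coefficient of the ways to insert first the edge `c`, then the edge `b`. -/
noncomputable def pairSign (I : Set Z.Edge) (b c : Z.Edge) : k :=
  ∑ d : Into Z, ((d.1.size).factorial : k)⁻¹ *
    (faceSign k d.2 b * relSign k (Set.range (edgeMap d.2)) I c)

-- The subtree has n! labellings, each of weight 1/n!.
open Classical in
theorem sum_labellings [CharZero k] {E : Set Z.Edge} (hE : IsSubtree E) :
    ∑ d : Into Z, (if Set.range (edgeMap d.2) = E then ((d.1.size).factorial : k)⁻¹ else 0) = 1 := by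
  rw [← Finset.sum_filter, Finset.sum_congr rfl
    (fun d hd => by rw [size_of_range d.2 (Finset.mem_filter.1 hd).2]), Finset.sum_const,
    nsmul_eq_mul]
  have h := card_labellings hE
  rw [Nat.card_eq_fintype_card, Fintype.card_subtype] at h
  rw [h]
  exact mul_inv_cancel₀ (by exact_mod_cast Nat.factorial_ne_zero _)

-- Since b is inserted last, the intermediate subtree is forced: either Z without b or Z without the
-- edges above b. By `sum_labellings` its labellings have total weight one.
open Classical in
theorem pairSign_eq [CharZero k] (I : Set Z.Edge) (b c : Z.Edge) :
    pairSign k I b c =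
      (if b ≠ ⊥ ∧ ¬ IsMax b then relSign k {b}ᶜ I c else 0) -
        (if IsTop b then relSign k {x | ¬ b < x} I c else 0) := by
  have key : ∀ (P : Prop) [Decidable P] (E : Set Z.Edge) (_ : P → IsSubtree E),
      ∑ d : Into Z, ((d.1.size).factorial : k)⁻¹ *
        ((if P ∧ Set.range (edgeMap d.2) = E then 1 else 0) *
          relSign k (Set.range (edgeMap d.2)) I c) = if P then relSign k E I c else 0 := by
    intro P _ E hE
    by_cases hP : P
    · rw [if_pos hP]
      conv_rhs => rw [← one_mul (relSign k E I c), ← sum_labellings k (hE hP), Finset.sum_mul]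
      refine Finset.sum_congr rfl fun d _ => ?_
      by_cases h : Set.range (edgeMap d.2) = E
      · simp [hP, h]
      · simp [h]
    · simp [hP]
  rw [← key _ _ (fun h => isSubtree_compl_singleton h.1 h.2),
    ← key _ _ (fun _ => isSubtree_not_lt b), ← Finset.sum_sub_distrib]
  refine Finset.sum_congr rfl fun d _ => ?_
  rw [← mul_sub, ← sub_mul]
  congr 2
  exact congrArg₂ (· - ·) (if_congr (isInnerFace_iff d.2 b) rfl rfl)
    (if_congr (isTopFace_iff d.2 b) rfl rfl)

theorem pairSign_comm [CharZero k] (I : Set Z.Edge) (b c : Z.Edge) :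
    pairSign k I b c = pairSign k I c b := by
  classical
  -- The nested terms have dropped out: contracting b and then chopping at c counts -1, chopping at
  -- b and then at c counts +1. The right hand side is visibly symmetric, its last two terms being
  -- exchanged.
  have h : ∀ b c : Z.Edge, pairSign k I b c =
      (if RelContract I b c then 1 else 0) + (if RelChop I b c then 1 else 0) -
        (if RelDisjoint I b c then 1 else 0) - (if RelDisjoint I c b then 1 else 0) := by
    intro b c
    have hand : ∀ (P Q : Prop) [Decidable P] [Decidable Q] (x : k), (if P then (if Q then x else 0) else 0) =
        if P ∧ Q then x else 0 := fun P Q _ _ x => by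
      split_ifs <;> simp_all
    have hor : ∀ (P Q : Prop) [Decidable P] [Decidable Q], (P → ¬ Q) → (if P ∨ Q then (1 : k) else 0) =
        (if P then 1 else 0) + (if Q then 1 else 0) := fun P Q _ _ h => by
      split_ifs <;> simp_all
    have hsub : ∀ (P : Prop) [Decidable P] (x y : k), (if P then x - y else 0) =
        (if P then x else 0) - (if P then y else 0) := fun P _ x y => by
      split_ifs <;> simp
    rw [pairSign_eq]
    unfold relSign
    rw [hsub, hsub, hand, hand, hand, hand, if_congr (inner_inner_iff I b c) rfl rfl,
      if_congr (inner_top_iff I b c) rfl rfl, if_congr (top_inner_iff I b c) rfl rfl,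
      if_congr (top_top_iff I b c) rfl rfl, hor _ _ (fun h h' => h.2.2.2.1 h'.2.1),
      hor _ _ (fun h h' => h.2.2.1 h'.2.1)]
    ring
  have h1 : RelContract I b c ↔ RelContract I c b := by
    constructor <;> rintro ⟨h1, h2, h3, h4, h5, h6⟩ <;>
      exact ⟨Ne.symm h1, h3, h2, h5, h4, h6.trans (Set.ext fun x => and_comm)⟩
  have h2 : RelChop I b c ↔ RelChop I c b := by
    constructor <;> rintro ⟨h1, h2, h3, h4, h5, h6⟩ <;>
      exact ⟨Ne.symm h1, h3, h2, h5, h4, h6.trans (Set.ext fun x => and_comm)⟩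
  rw [h b c, h c b, if_congr h1 rfl rfl, if_congr h2 rfl rfl]
  ring

end RelFace

section Square

variable {k : Type u} [Field k] [CharZero k] {V : Type v} [AddCommGroup V] [Module k V]
  {T : RTree} {p : ℕ}

/-- Exchanging the first two positions is an odd permutation. -/
theorem Fam.raw_swap {F : Fam T (p + 2) V} (hF : F.IsAlt) (X : RTree) (g : T ⟶ X)
    (ε : Fin p → X.Edge) (b c : X.Edge) :
    F.raw X g (Fin.cons b (Fin.cons c ε : Fin (p + 1) → X.Edge)) =
      -F.raw X g (Fin.cons c (Fin.cons b ε : Fin (p + 1) → X.Edge)) := by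
  have h := Fam.raw_comp_perm hF X g (Fin.cons c (Fin.cons b ε : Fin (p + 1) → X.Edge))
    (Equiv.swap 0 1)
  rw [Equiv.Perm.sign_swap Fin.zero_ne_one, Units.neg_smul, one_smul] at h
  rw [← h]
  congr 1
  funext i
  refine Fin.cases ?_ (fun j => Fin.cases ?_ (fun l => ?_) j) i
  · simp
  · rw [Function.comp_apply, show Fin.succ (0 : Fin (p + 1)) = 1 from rfl,
      Equiv.swap_apply_right]
    rfl
  · have h0 : l.succ.succ ≠ 0 := Fin.succ_ne_zero _
    have h1 : l.succ.succ ≠ 1 := fun h => Fin.succ_ne_zero l (Fin.succ_injective _ h)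
    simp [Equiv.swap_apply_of_ne_of_ne h0 h1]

/-- The composition of an element of `Out T` with a map of trees. -/
abbrev Out.comp (x : Out T) (y : Out x.1) : Out T := ⟨y.1, x.2 ≫ y.2⟩

/-- Sums over composable pairs of maps out of `T` as sums over their composites. -/
theorem sum_out_out (N : ℕ) (f : ∀ Z : Out T, Into Z.1 → V)
    (hf : ∀ (Z : Out T) (d : Into Z.1),
      ¬ Set.range (edgeMap Z.2) ⊆ Set.range (edgeMap d.2) → f Z d = 0) :
    ∑ x ∈ Out.upTo T N, ∑ y ∈ Out.upTo x.1 N, f (x.comp y) ⟨x.1, y.2⟩ =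
      ∑ Z ∈ Out.upTo T N, ∑ d : Into Z.1, f Z d := by
  classical
  have h1 : ∀ Z : Out T, ∑ d : Into Z.1, f Z d =
      ∑ d ∈ Finset.univ.filter (fun d : Into Z.1 =>
        Set.range (edgeMap Z.2) ⊆ Set.range (edgeMap d.2)), f Z d := fun Z => by
    rw [Finset.sum_filter]
    refine Finset.sum_congr rfl fun d _ => ?_
    split_ifs with h
    · rfl
    · exact hf Z d h
  simp only [h1]
  rw [Finset.sum_sigma', Finset.sum_sigma']
  -- The pair (g, d) goes to its composite together with d. It is injective because d is a
  -- monomorphism, and surjective onto the pairs with nested images by `exists_lift`.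
  refine Finset.sum_bij (fun a _ => ⟨a.1.comp a.2, ⟨a.1.1, a.2.2⟩⟩) ?_ ?_ ?_ ?_
  · rintro ⟨⟨X, g⟩, ⟨Y, d⟩⟩ h
    obtain ⟨-, hY⟩ := Finset.mem_sigma.1 h
    have hY : Y.size ≤ N := Out.mem_upTo.1 hY
    refine Finset.mem_sigma.2 ⟨Out.mem_upTo.2 hY,
      Finset.mem_filter.2 ⟨Finset.mem_univ _, ?_⟩⟩
    rintro _ ⟨a, rfl⟩
    exact ⟨edgeMap g a, rfl⟩
  · rintro ⟨⟨X, g⟩, ⟨Y, d⟩⟩ _ ⟨⟨X', g'⟩, ⟨Y', d'⟩⟩ _ h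
    simp only [Sigma.mk.injEq] at h
    obtain ⟨⟨rfl, h1⟩, h2⟩ := h
    have h2 := eq_of_heq h2
    simp only [Sigma.mk.injEq] at h2
    obtain ⟨rfl, h2⟩ := h2
    obtain rfl := eq_of_heq h2
    obtain rfl := hom_cancel d (eq_of_heq h1)
    rfl
  · rintro ⟨⟨Z, z⟩, ⟨X, d⟩⟩ h
    obtain ⟨hZ, hd⟩ := Finset.mem_sigma.1 h
    have hl := (Finset.mem_filter.1 hd).2
    have hZ : Z.size ≤ N := Out.mem_upTo.1 hZ
    clear h hd
    obtain ⟨g, hg⟩ := exists_lift z d hl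
    clear hl
    exact ⟨⟨⟨X, g⟩, ⟨Z, d⟩⟩, Finset.mem_sigma.2
      ⟨Out.mem_upTo.2 ((size_le_of_hom d).trans hZ), Out.mem_upTo.2 hZ⟩, by rw [← hg]⟩
  · intros
    rfl

/-- The sum over all faces squares to zero. -/
theorem faceSum_faces {F : Fam T (p + 2) V} (hF : F.IsAlt) (e : Enum T p) :
    faceSum k (F.faces k) e = 0 := by
  classical
  obtain ⟨N, hN⟩ := hF.bdd
  let G : ∀ Z : Out T, Z.1.Edge → Z.1.Edge → V := fun Z b c =>
    F.raw Z.1 Z.2 (Fin.cons b (Fin.cons c (edgeMap Z.2 ∘ e.edge) : Fin (p + 1) → Z.1.Edge))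
  -- The edge c is inserted by the first face T → X and b by the second face X → Z. Both range over
  -- all edges of Z, with vanishing coefficients for impossible choices.
  let f : ∀ Z : Out T, Into Z.1 → V := fun Z d =>
    ((Z.1.size).factorial : k)⁻¹ • ((d.1.size).factorial : k)⁻¹ • ∑ c : Z.1.Edge, ∑ b : Z.1.Edge,
      (faceSign k d.2 b * relSign k (Set.range (edgeMap d.2)) (Set.range (edgeMap Z.2)) c) •
        G Z b c
  have hf : ∀ (Z : Out T) (d : Into Z.1),
      ¬ Set.range (edgeMap Z.2) ⊆ Set.range (edgeMap d.2) → f Z d = 0 := by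
    intro Z d h
    have : ∀ c, relSign k (Set.range (edgeMap d.2)) (Set.range (edgeMap Z.2)) c = 0 := fun c =>
      relSign_eq_zero k fun h' => h h'.2
    simp [f, this]
  have h1 : faceSum k (F.faces k) e =
      ∑ x ∈ Out.upTo T N, ∑ y ∈ Out.upTo x.1 N, f (x.comp y) ⟨x.1, y.2⟩ := by
    rw [faceSum_eq k hF.faces (hN.faces hF)]
    refine Finset.sum_congr rfl fun x _ => ?_
    have hx : ∀ b : x.1.Edge, faceSign k x.2 b •
        (F.faces k).raw x.1 x.2 (Fin.cons b (edgeMap x.2 ∘ e.edge)) =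
        ∑ y ∈ Out.upTo x.1 N, ((y.1.size).factorial : k)⁻¹ • ∑ b' : y.1.Edge,
          (faceSign k y.2 b' * faceSign k x.2 b) • G (x.comp y) b' (edgeMap y.2 b) := by
      intro b
      have hface : ∀ h : IsNewEdge x.2 b,
          (F.faces k).raw x.1 x.2 (Fin.cons b (edgeMap x.2 ∘ e.edge)) =
          ∑ y ∈ Out.upTo x.1 N, ((y.1.size).factorial : k)⁻¹ • ∑ b' : y.1.Edge,
            faceSign k y.2 b' • G (x.comp y) b' (edgeMap y.2 b) := by
        intro h
        refine ((F.faces k).raw_edge x.1 x.2 (e.cons x.2 b h)).trans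
          ((faceSum_eq k (hF.precomp x.2) (hN.precomp x.2) _).trans ?_)
        refine Finset.sum_congr rfl fun y _ => ?_
        congr 1
        refine Finset.sum_congr rfl fun b' _ => ?_
        congr 1
        rw [Fam.raw_precomp]
        have : edgeMap y.2 ∘ (e.cons x.2 b h).edge =
            Fin.cons (edgeMap y.2 b) (edgeMap (x.comp y).2 ∘ e.edge) := by
          funext i
          exact Fin.cases rfl (fun j => rfl) i
        rw [this]
      by_cases h : IsNewEdge x.2 b
      · rw [hface h, Finset.smul_sum]
        refine Finset.sum_congr rfl fun y _ => ?_
        rw [smul_comm, Finset.smul_sum]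
        congr 1
        exact Finset.sum_congr rfl fun b' _ => by rw [smul_smul, mul_comm]
      -- When b is not a new edge, the sequence of edges need not be an enumeration, but the
      -- coefficient is zero.
      · have h0 : faceSign k x.2 b = 0 := by
          unfold faceSign
          rw [if_neg fun h' => h h'.isNewEdge, if_neg fun h' => h h'.isNewEdge, sub_zero]
        simp [h0]
    rw [Finset.sum_congr rfl fun b _ => hx b, Finset.sum_comm, Finset.smul_sum]
    refine Finset.sum_congr rfl fun y _ => ?_
    rw [← Finset.smul_sum, smul_comm]
    change _ = ((y.1.size).factorial : k)⁻¹ • ((x.1.size).factorial : k)⁻¹ • _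
    congr 2
    have hinj : Function.Injective (edgeMap y.2) := (edgeMap y.2).injective
    -- The sum over the edges of X becomes one over the edges of Z, as `relSign` vanishes off the
    -- image of X.
    refine Finset.sum_of_injOn (edgeMap y.2) hinj.injOn (by simp) ?_ ?_
    · intro c _ hc
      have : relSign k (Set.range (edgeMap y.2)) (Set.range (edgeMap (x.2 ≫ y.2))) c = 0 :=
        relSign_eq_zero k fun h => hc (by simpa using h.1)
      simp [this]
    · intro b _
      refine Finset.sum_congr rfl fun b' _ => ?_
      rw [faceSign_eq_relSign k x.2 y.2 b]
  rw [h1, sum_out_out N f hf]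
  refine Finset.sum_eq_zero fun Z _ => ?_
  have h2 : ∑ d : Into Z.1, f Z d = ((Z.1.size).factorial : k)⁻¹ • ∑ c : Z.1.Edge, ∑ b : Z.1.Edge,
      pairSign k (Set.range (edgeMap Z.2)) b c • G Z b c := by
    rw [← Finset.smul_sum]
    congr 1
    simp only [Finset.smul_sum, smul_smul]
    rw [Finset.sum_comm]
    refine Finset.sum_congr rfl fun c _ => ?_
    rw [Finset.sum_comm]
    refine Finset.sum_congr rfl fun b _ => ?_
    rw [← Finset.sum_smul]
    rfl
  have h3 : ∑ c : Z.1.Edge, ∑ b : Z.1.Edge,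
      pairSign k (Set.range (edgeMap Z.2)) b c • G Z b c = 0 := by
    -- A symmetric coefficient paired with an antisymmetric family: exchanging the names of b and c
    -- negates the sum.
    have : ∑ c : Z.1.Edge, ∑ b : Z.1.Edge, pairSign k (Set.range (edgeMap Z.2)) b c • G Z b c =
        -∑ c : Z.1.Edge, ∑ b : Z.1.Edge, pairSign k (Set.range (edgeMap Z.2)) b c • G Z b c := by
      conv_lhs => rw [Finset.sum_comm]
      rw [← Finset.sum_neg_distrib]
      refine Finset.sum_congr rfl fun c _ => ?_
      rw [← Finset.sum_neg_distrib]
      refine Finset.sum_congr rfl fun b _ => ?_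
      rw [pairSign_comm, ← smul_neg]
      congr 1
      exact Fam.raw_swap hF _ _ _ _ _
    have h4 : (2 : k) • ∑ c : Z.1.Edge, ∑ b : Z.1.Edge,
        pairSign k (Set.range (edgeMap Z.2)) b c • G Z b c = 0 := by
      rw [two_smul]
      nth_rewrite 1 [this]
      exact neg_add_cancel _
    exact (smul_eq_zero.1 h4).resolve_left two_ne_zero
  rw [h2, h3, smul_zero]

end Square

/-! ### Chain complexes -/

section Complex

variable {k : Type u} [Field k]

/-- The chain complex with given differentials `X n ⟶ X (n - 1)`. -/
def chainComplexOf (X : ℤ → ModuleCat.{v} k) (d : ∀ n, X n ⟶ X (n - 1))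
    (h : ∀ n, d n ≫ d (n - 1) = 0) : ChainComplex (ModuleCat.{v} k) ℤ where
  X := X
  d i j := if hij : j = i - 1 then d i ≫ eqToHom (by rw [hij]) else 0
  shape i j hij := dif_neg fun h => hij (by subst h; exact sub_add_cancel i 1)
  d_comp_d' i j l hij hjl := by
    obtain rfl : j = i - 1 := eq_sub_of_add_eq hij
    obtain rfl : l = i - 1 - 1 := eq_sub_of_add_eq hjl
    rw [dif_pos rfl, dif_pos rfl, eqToHom_refl, eqToHom_refl, Category.comp_id, Category.comp_id, h]

theorem chainComplexOf_d (X : ℤ → ModuleCat.{v} k) (d : ∀ n, X n ⟶ X (n - 1))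
    (h : ∀ n, d n ≫ d (n - 1) = 0) (n : ℤ) : (chainComplexOf X d h).d n (n - 1) = d n := by
  change (if hij : n - 1 = n - 1 then d n ≫ eqToHom _ else 0) = _
  rw [dif_pos rfl, eqToHom_refl, Category.comp_id]

/-- A chain map given in each degree. -/
def chainMapOf {A B : ChainComplex (ModuleCat.{v} k) ℤ} (f : ∀ n, A.X n ⟶ B.X n)
    (h : ∀ n, f n ≫ B.d n (n - 1) = A.d n (n - 1) ≫ f (n - 1)) : A ⟶ B where
  f := f
  comm' i j hij := by
    obtain rfl : j = i - 1 := eq_sub_of_add_eq hij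
    exact h i

theorem hom_d_apply {A B : ChainComplex (ModuleCat.{v} k) ℤ} (f : A ⟶ B) (i j : ℤ) (x : A.X i) :
    (f.f j).hom ((A.d i j).hom x) = (B.d i j).hom ((f.f i).hom x) :=
  (congrArg (fun g => g.hom x) (f.comm i j)).symm

theorem d_d_apply (A : ChainComplex (ModuleCat.{v} k) ℤ) (i j l : ℤ) (x : A.X i) :
    (A.d j l).hom ((A.d i j).hom x) = 0 :=
  congrArg (fun g => g.hom x) (A.d_comp_d i j l)

theorem psh_map_comp (M : Psh.{u, v} k) {R S T : RTree} (g : R ⟶ S) (h : S ⟶ T) (m : ℤ)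
    (x : (M.obj (op T)).X m) :
    ((M.map (g ≫ h).op).f m).hom x = ((M.map g.op).f m).hom (((M.map h.op).f m).hom x) :=
  congrArg (fun z => (z.f m).hom x) (M.map_comp h.op g.op)

theorem psh_map_id (M : Psh.{u, v} k) (S : RTree) (m : ℤ) (x : (M.obj (op S)).X m) :
    ((M.map (𝟙 S : S ⟶ S).op).f m).hom x = x :=
  congrArg (fun z => (z.f m).hom x) (M.map_id (op S))

theorem psh_naturality {M M' : Psh.{u, v} k} (f : M ⟶ M') {S T : RTree} (g : S ⟶ T) (m : ℤ)
    (x : (M.obj (op T)).X m) :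
    ((f.app (op S)).f m).hom (((M.map g.op).f m).hom x) =
      ((M'.map g.op).f m).hom (((f.app (op T)).f m).hom x) :=
  congrArg (fun z => (z.f m).hom x) (f.naturality g.op)

theorem copsh_map_comp (N : CoPsh.{u, v} k) {R S T : RTree} (g : R ⟶ S) (h : S ⟶ T) (m : ℤ)
    (x : (N.obj R).X m) :
    ((N.map (g ≫ h)).f m).hom x = ((N.map h).f m).hom (((N.map g).f m).hom x) :=
  congrArg (fun z => (z.f m).hom x) (N.map_comp g h)

theorem copsh_map_id (N : CoPsh.{u, v} k) (S : RTree) (m : ℤ) (x : (N.obj S).X m) :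
    ((N.map (𝟙 S)).f m).hom x = x :=
  congrArg (fun z => (z.f m).hom x) (N.map_id S)

theorem copsh_naturality {N N' : CoPsh.{u, v} k} (f : N ⟶ N') {S T : RTree} (g : S ⟶ T) (m : ℤ)
    (x : (N.obj S).X m) :
    ((f.app T).f m).hom (((N.map g).f m).hom x) =
      ((N'.map g).f m).hom (((f.app S).f m).hom x) :=
  congrArg (fun z => (z.f m).hom x) (f.naturality g)

end Complex

/-! ### Finite sets of isomorphism classes -/

/-- The number of edges of the target. -/
def ArrowClass.size {S : RTree} : ArrowClass S → ℕ :=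
  Quotient.lift (fun X : Under S => X.right.size) fun _ _ h =>
    h.elim fun i => size_eq_of_iso ((Under.forget S).mapIso i)

/-- There are finitely many labelled maps to trees with at most N edges, so finiteness up to
isomorphism is just a bound on the number of edges. -/
theorem ArrowClass.finite_iff {S : RTree} (A : Set (ArrowClass S)) :
    A.Finite ↔ ∃ N, ∀ x ∈ A, x.size ≤ N := by
  constructor
  · intro h
    obtain ⟨N, hN⟩ := (h.image ArrowClass.size).bddAbove
    exact ⟨N, fun x hx => hN ⟨x, hx, rfl⟩⟩
  · rintro ⟨N, hN⟩
    refine ((Out.finite_size_le S N).image fun p => arrowClass p.2).subset fun x hx => ?_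
    induction x using Quotient.inductionOn with
    | h X => exact ⟨⟨X.right, X.hom⟩, hN _ hx, rfl⟩

/-- This is the bound on the family of face sums, read at the identity of T. -/
theorem faceSum_eq_zero_of_lt {k : Type u} [Field k] [CharZero k] {V : Type v} [AddCommGroup V]
    [Module k V] {T : RTree} {p : ℕ} {F : Fam T (p + 1) V} (hF : F.IsAlt) {N : ℕ}
    (hN : F.BddBy N) (e : Enum T p) (hT : N < T.size) : faceSum k F e = 0 :=
  hN.faces hF T (𝟙 T) e hT

/-! ### The bar functor -/

section Bar

variable {k : Type u} [Field k]

/-- The family `g^* ω_{gα}(e)`. -/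
def barFam (M : Psh.{u, v} k) {S : RTree} {n : ℤ} (ω : BarFamily M S n) {T : RTree} (α : S ⟶ T)
    (m : ℤ) (q : ℕ) (h : m + q = n) : Fam T q ((M.obj (op T)).X m) := fun X g e =>
  ((M.map g.op).f m).hom (ω ⟨⟨X, α ≫ g, q, e, m⟩, h⟩)

theorem barDiff_eq (M : Psh.{u, v} k) (S : RTree) (n : ℤ) (ω : BarFamily M S n)
    (c : BarCell S (n - 1)) :
    barDiff M S n ω c = ((M.obj (op c.1.tree)).d (c.1.deg + 1) c.1.deg).hom
      (ω ⟨c.1.withDeg (c.1.deg + 1), by have := c.2; dsimp only; omega⟩) +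
      n.negOnePow • faceSum k (barFam M ω c.1.map c.1.deg (c.1.len + 1)
        (by have := c.2; push_cast; omega)) c.1.enum := by
  rw [faceSum, smul_sub, ← add_sub_assoc]
  rfl

/-- `ω` vanishes on all maps whose target has more than `N` edges. -/
def BarFamily.BddBy {M : Psh.{u, v} k} {S : RTree} {n : ℤ} (ω : BarFamily M S n) (N : ℕ) : Prop :=
  ∀ c : BarCell S n, N < c.1.tree.size → ω c = 0

theorem mem_barModule_iff {M : Psh.{u, v} k} {S : RTree} {n : ℤ} (ω : BarFamily M S n) :
    ω ∈ barModule M S n ↔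
      (∀ (c : BarCell S n) (σ : Equiv.Perm (Fin c.1.len)),
        ω ⟨c.1.perm σ, c.2⟩ = Equiv.Perm.sign σ • ω c) ∧
      (∀ (c : BarCell S n) (T' : RTree) (γ : c.1.tree ≅ T'),
        ω c = ((M.map γ.hom.op).f c.1.deg).hom (ω ⟨c.1.transport γ, c.2⟩)) ∧
      ∃ N, ω.BddBy N := by
  refine and_congr_right' (and_congr_right' ?_)
  rw [ArrowClass.finite_iff]
  refine exists_congr fun N => ⟨fun h c hc => ?_, ?_⟩
  · by_contra hne
    exact absurd (h _ ⟨c, rfl, hne⟩) (not_le.2 hc)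
  · rintro h _ ⟨c, rfl, hne⟩
    exact not_lt.1 fun hc => hne (h c hc)

theorem barFam_bddBy {M : Psh.{u, v} k} {S : RTree} {n : ℤ} {ω : BarFamily M S n} {N : ℕ}
    (hN : ω.BddBy N) {T : RTree} (α : S ⟶ T) (m : ℤ) (q : ℕ) (h : m + q = n) :
    (barFam M ω α m q h).BddBy N := fun X g e hX => by
  unfold barFam
  rw [hN ⟨⟨X, α ≫ g, q, e, m⟩, h⟩ hX, map_zero]

/-- Pulling back along g puts all values into the single module M(T)_m. The three conditions on ω
then become those on a family, by functoriality of M. -/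
theorem barFam_isAlt {M : Psh.{u, v} k} {S : RTree} {n : ℤ} {ω : BarFamily M S n}
    (hω : ω ∈ barModule M S n) {T : RTree} (α : S ⟶ T) (m : ℤ) (q : ℕ) (h : m + q = n) :
    (barFam M ω α m q h).IsAlt := by
  obtain ⟨h1, h2, N, hN⟩ := (mem_barModule_iff ω).1 hω
  refine ⟨fun X g e σ => ?_, fun X X' g e γ => ?_, N, barFam_bddBy hN α m q h⟩
  · refine (congrArg _ (h1 ⟨⟨X, α ≫ g, q, e, m⟩, h⟩ σ)).trans ?_
    rw [Units.smul_def, map_zsmul, ← Units.smul_def]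
    rfl
  · refine (psh_map_comp M g γ.hom m _).trans ?_
    exact congrArg _ (h2 ⟨⟨X, α ≫ g, q, e, m⟩, h⟩ X' γ).symm

theorem map_barFam (M : Psh.{u, v} k) {S : RTree} {n : ℤ} (ω : BarFamily M S n) {T T' : RTree}
    (α : S ⟶ T) (β : T ⟶ T') (m : ℤ) (q : ℕ) (h : m + q = n) :
    (fun X g e => ((M.map β.op).f m).hom (barFam M ω (α ≫ β) m q h X g e)) =
      (barFam M ω α m q h).precomp β := by
  funext X g e
  exact (psh_map_comp M β g m _).symm

theorem precomp_mem_barModule {M : Psh.{u, v} k} {S R : RTree} (β : S ⟶ R) {n : ℤ}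
    {ω : BarFamily M S n} (hω : ω ∈ barModule M S n) :
    (fun c : BarCell R n => ω ⟨c.1.precomp β, c.2⟩) ∈ barModule M R n := by
  obtain ⟨h1, h2, N, hN⟩ := (mem_barModule_iff ω).1 hω
  exact (mem_barModule_iff _).2 ⟨fun c σ => h1 ⟨c.1.precomp β, c.2⟩ σ,
    fun c T' γ => h2 ⟨c.1.precomp β, c.2⟩ T' γ, N, fun c hc => hN ⟨c.1.precomp β, c.2⟩ hc⟩

/-- The action of a map of trees on the bar construction in degree `n`. -/
def barPush (M : Psh.{u, v} k) {S R : RTree} (β : S ⟶ R) (n : ℤ) :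
    barModule M S n →ₗ[k] barModule M R n where
  toFun ω := ⟨fun c => ω.1 ⟨c.1.precomp β, c.2⟩, precomp_mem_barModule β ω.2⟩
  map_add' _ _ := rfl
  map_smul' _ _ := rfl

theorem app_mem_barModule {M M' : Psh.{u, v} k} (f : M ⟶ M') {S : RTree} {n : ℤ}
    {ω : BarFamily M S n} (hω : ω ∈ barModule M S n) :
    (fun c : BarCell S n => ((f.app (op c.1.tree)).f c.1.deg).hom (ω c)) ∈ barModule M' S n := by
  obtain ⟨h1, h2, N, hN⟩ := (mem_barModule_iff ω).1 hω
  refine (mem_barModule_iff _).2 ⟨fun c σ => ?_, fun c T' γ => ?_, N, fun c hc => ?_⟩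
  · refine (congrArg _ (h1 c σ)).trans ?_
    rw [Units.smul_def, map_zsmul, ← Units.smul_def]
  · exact (congrArg _ (h2 c T' γ)).trans (psh_naturality f γ.hom _ _)
  · exact (congrArg _ (hN c hc)).trans (map_zero _)

variable [CharZero k]

theorem map_faceSum_barFam {M : Psh.{u, v} k} {S : RTree} {n : ℤ} {ω : BarFamily M S n}
    (hω : ω ∈ barModule M S n) {T T' : RTree} (α : S ⟶ T) (β : T ⟶ T') (m : ℤ) (q : ℕ)
    (h : m + (q + 1 : ℕ) = n) (e : Enum T' q) :
    ((M.map β.op).f m).hom (faceSum k (barFam M ω (α ≫ β) m (q + 1) h) e) =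
      faceSum k ((barFam M ω α m (q + 1) h).precomp β) e := by
  rw [map_faceSum _ (barFam_isAlt hω (α ≫ β) m _ h), map_barFam]

/-- The symmetries pass to both terms. The same bound N still works because a face has a target with
at least as many edges as its source. -/
theorem barDiff_mem {M : Psh.{u, v} k} {S : RTree} {n : ℤ} {ω : BarFamily M S n}
    (hω : ω ∈ barModule M S n) : barDiff M S n ω ∈ barModule M S (n - 1) := by
  obtain ⟨h1, h2, N, hN⟩ := (mem_barModule_iff ω).1 hω
  refine (mem_barModule_iff _).2 ⟨fun c σ => ?_, fun c T' γ => ?_, N, fun c hc => ?_⟩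
  · have hc := c.2
    rw [barDiff_eq, barDiff_eq, smul_add]
    congr 1
    · refine (congrArg _ (h1 ⟨c.1.withDeg (c.1.deg + 1), by dsimp only; omega⟩ σ)).trans ?_
      rw [Units.smul_def, map_zsmul, ← Units.smul_def]
    · rw [smul_comm]
      exact congrArg _ (faceSum_perm (barFam_isAlt hω _ _ _ _) c.1.enum σ)
  · have hc := c.2
    rw [barDiff_eq, barDiff_eq, map_add]
    congr 1
    · refine (congrArg _ (h2 ⟨c.1.withDeg (c.1.deg + 1), by dsimp only; omega⟩ T' γ)).trans ?_
      exact (hom_d_apply (M.map γ.hom.op) _ _ _).symm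
    · rw [Units.smul_def, Units.smul_def, map_zsmul]
      congr 1
      rw [← faceSum_iso (barFam_isAlt hω _ _ _ _) c.1.enum γ]
      exact (map_faceSum_barFam hω c.1.map γ.hom c.1.deg c.1.len _ _).symm
  · rw [barDiff_eq, hN ⟨c.1.withDeg (c.1.deg + 1), _⟩ hc, map_zero, zero_add,
      faceSum_eq_zero_of_lt (barFam_isAlt hω _ _ _ _) (barFam_bddBy hN _ _ _ _) _ hc, smul_zero]

/-- The differential of the bar construction as a linear map. -/
noncomputable def barD (M : Psh.{u, v} k) (S : RTree) (n : ℤ) :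
    barModule M S n →ₗ[k] barModule M S (n - 1) where
  toFun ω := ⟨barDiff M S n ω.1, barDiff_mem ω.2⟩
  map_add' ω ω' := by
    refine Subtype.ext (funext fun c => ?_)
    change barDiff M S n (ω.1 + ω'.1) c = barDiff M S n ω.1 c + barDiff M S n ω'.1 c
    rw [barDiff_eq, barDiff_eq, barDiff_eq, Pi.add_apply, map_add, add_add_add_comm, ← smul_add,
      ← faceSum_add (barFam_isAlt ω.2 _ _ _ _) (barFam_isAlt ω'.2 _ _ _ _)]
    congr 3
    funext X g e
    exact map_add _ _ _
  map_smul' r ω := by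
    refine Subtype.ext (funext fun c => ?_)
    change barDiff M S n (r • ω.1) c = r • barDiff M S n ω.1 c
    rw [barDiff_eq, barDiff_eq, Pi.smul_apply, map_smul, smul_add, smul_comm r,
      ← faceSum_smul r (barFam_isAlt ω.2 _ _ _ _)]
    congr 3
    funext X g e
    exact map_smul _ _ _

/-- The two internal differentials compose to zero and so do the two face sums. The mixed terms
agree up to the signs (-1)^n and (-1)^(n-1), hence cancel. -/
theorem barD_barD (M : Psh.{u, v} k) (S : RTree) (n : ℤ) (ω : barModule M S n) :
    barD M S (n - 1) (barD M S n ω) = 0 := by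
  refine Subtype.ext (funext fun c => ?_)
  change barDiff M S (n - 1) (barDiff M S n ω.1) c = 0
  have hc := c.2
  let A : Fam c.1.tree (c.1.len + 1) ((M.obj (op c.1.tree)).X c.1.deg) := fun X g e =>
    ((M.obj (op c.1.tree)).d (c.1.deg + 1) c.1.deg).hom
      (barFam M ω.1 c.1.map (c.1.deg + 1) (c.1.len + 1) (by push_cast; omega) X g e)
  have hA : A.IsAlt := (barFam_isAlt ω.2 _ _ _ _).map
    ((M.obj (op c.1.tree)).d (c.1.deg + 1) c.1.deg).hom.toAddMonoidHom
  let B := barFam M ω.1 c.1.map c.1.deg (c.1.len + 2) (by push_cast; omega)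
  have hB : B.IsAlt := barFam_isAlt ω.2 _ _ _ _
  -- The family attached to ∂ω splits into the internal differential of the family of ω and, up to
  -- sign, its family of face sums. This uses that each g^* is a chain map and commutes with face
  -- sums.
  have hAB : barFam M (barDiff M S n ω.1) c.1.map c.1.deg (c.1.len + 1) (by push_cast; omega) =
      A + fun X g e => n.negOnePow • B.faces k X g e := by
    funext X g e
    change _ = A X g e + n.negOnePow • B.faces k X g e
    refine (congrArg _ (barDiff_eq M S n ω.1 _)).trans ?_
    rw [map_add]
    congr 1
    · exact hom_d_apply _ _ _ _
    · rw [Units.smul_def, Units.smul_def, map_zsmul]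
      congr 1
      exact map_faceSum_barFam ω.2 c.1.map g c.1.deg (c.1.len + 1) _ e
  rw [barDiff_eq, barDiff_eq, hAB, map_add, d_d_apply, zero_add, Units.smul_def, map_zsmul,
    ← Units.smul_def, faceSum_add hA, faceSum_negOnePow_smul n hB.faces, faceSum_faces hB,
    smul_zero, add_zero, map_faceSum _ (barFam_isAlt ω.2 _ _ _ _), Int.negOnePow_sub,
    Int.negOnePow_one, mul_neg, mul_one, Units.neg_smul]
  · exact add_neg_cancel _
  · exact hB.faces.map (DistribSMul.toAddMonoidHom _ n.negOnePow)

/-- The bar construction at `S`. -/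
noncomputable def barComplex (M : Psh.{u, v} k) (S : RTree) : ChainComplex (ModuleCat.{v} k) ℤ :=
  chainComplexOf (fun n => ModuleCat.of k (barModule M S n)) (fun n => ModuleCat.ofHom (barD M S n))
    fun n => ModuleCat.hom_ext (LinearMap.ext fun ω => barD_barD M S n ω)

theorem barComplex_d (M : Psh.{u, v} k) (S : RTree) (n : ℤ) :
    (barComplex M S).d n (n - 1) = ModuleCat.ofHom (barD M S n) :=
  chainComplexOf_d _ _ _ n

theorem barComplex_d_apply (M : Psh.{u, v} k) (S : RTree) (n : ℤ) (ω : barModule M S n) :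
    ((barComplex M S).d n (n - 1)).hom ω = barD M S n ω :=
  congrArg (fun f => f.hom ω) (barComplex_d M S n)

/-- The action of a map of trees on the bar construction. -/
noncomputable def barMap (M : Psh.{u, v} k) {S R : RTree} (β : S ⟶ R) :
    barComplex M S ⟶ barComplex M R :=
  chainMapOf (fun n => ModuleCat.ofHom (X := barModule M S n) (Y := barModule M R n)
    (barPush M β n)) fun n => by
    rw [barComplex_d, barComplex_d]
    rfl

/-- The bar construction of a presheaf. -/
noncomputable def barCoPsh (M : Psh.{u, v} k) : CoPsh.{u, v} k where
  obj S := barComplex M S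
  map β := barMap M β
  map_id _ := rfl
  map_comp _ _ := rfl

/-- If ω vanishes on targets with more than N edges and T has more than N edges, every map S → T → X
ends in such a target, so α_* ω = 0. -/
theorem barCoPsh_isConilpotent (M : Psh.{u, v} k) : IsConilpotent k (barCoPsh M) := by
  intro S n y
  obtain ⟨N, hN⟩ := ((mem_barModule_iff _).1 (Subtype.property (p := (· ∈ barModule M S n)) y)).2.2
  refine (ArrowClass.finite_iff _).2 ⟨N, ?_⟩
  rintro _ ⟨T, α, rfl, hne⟩
  by_contra h
  refine hne (Subtype.ext (funext fun c => hN ⟨c.1.precomp α, c.2⟩ ?_))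
  exact (not_le.1 h).trans_le (size_le_of_hom c.1.map)

theorem barDiff_app {M M' : Psh.{u, v} k} (f : M ⟶ M') {S : RTree} {n : ℤ}
    {ω : BarFamily M S n} (hω : ω ∈ barModule M S n) (c : BarCell S (n - 1)) :
    barDiff M' S n (fun c => ((f.app (op c.1.tree)).f c.1.deg).hom (ω c)) c =
      ((f.app (op c.1.tree)).f c.1.deg).hom (barDiff M S n ω c) := by
  rw [barDiff_eq, barDiff_eq, map_add]
  congr 1
  · exact (hom_d_apply (f.app (op c.1.tree)) _ _ _).symm
  · rw [Units.smul_def, Units.smul_def, map_zsmul, map_faceSum _ (barFam_isAlt hω _ _ _ _)]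
    congr 2
    funext X g e
    exact (psh_naturality f g _ _).symm

/-- The action of a morphism of presheaves on the bar construction. -/
noncomputable def barApp {M M' : Psh.{u, v} k} (f : M ⟶ M') : barCoPsh M ⟶ barCoPsh M' where
  app S := chainMapOf (fun n => ModuleCat.ofHom (X := barModule M S n) (Y := barModule M' S n)
    { toFun := fun ω => ⟨fun c => ((f.app (op c.1.tree)).f c.1.deg).hom (ω.1 c),
        app_mem_barModule f ω.2⟩
      map_add' := fun _ _ => Subtype.ext (funext fun _ => map_add _ _ _)
      map_smul' := fun _ _ => Subtype.ext (funext fun _ => map_smul _ _ _) }) fun n => by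
    refine (congrArg (_ ≫ ·) (barComplex_d M' S n)).trans
      (Eq.trans ?_ (congrArg (· ≫ _) (barComplex_d M S n)).symm)
    exact ModuleCat.hom_ext (LinearMap.ext fun ω => Subtype.ext (funext fun c =>
      barDiff_app f ω.2 c))
  naturality _ _ _ := rfl

variable (k) in
/-- The bar functor. -/
noncomputable def barFunctor : Psh.{u, v} k ⥤ ConilpCoPsh.{u, v} k where
  obj M := ⟨barCoPsh M, barCoPsh_isConilpotent M⟩
  map f := ⟨barApp f⟩
  map_id _ := rfl
  map_comp _ _ := rfl

theorem isBarFunctor_barFunctor : IsBarFunctor (barFunctor.{u, v} k) := by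
  refine ⟨fun M S n => LinearEquiv.refl k (barModule M S n), fun M S n x => ?_,
    fun _ _ _ _ _ _ _ => rfl, fun _ _ _ _ _ _ _ => rfl⟩
  exact congrArg Subtype.val (barComplex_d_apply M S n x)

end Bar

/-! ### The cobar functor -/

section Cobar

variable {k : Type u} [Field k]

/-! ### Generators and relations of the cobar construction -/

section Generators

variable {N : CoPsh.{u, v} k} {S : RTree} {n : ℤ}

theorem cobarMk_add (c : CobarCell S n) (y y' : (N.obj c.1.tree).X c.1.deg) :
    cobarMk N S n c (y + y') = cobarMk N S n c y + cobarMk N S n c y' := by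
  unfold cobarMk cobarLof
  rw [map_add, map_add]

theorem cobarMk_smul (r : k) (c : CobarCell S n) (y : (N.obj c.1.tree).X c.1.deg) :
    cobarMk N S n c (r • y) = r • cobarMk N S n c y := by
  unfold cobarMk cobarLof
  rw [map_smul, map_smul]

theorem cobarMk_zero (c : CobarCell S n) : cobarMk N S n c 0 = 0 := by
  unfold cobarMk cobarLof
  rw [map_zero, map_zero]

theorem cobarMk_perm (c : CobarCell S n) (σ : Equiv.Perm (Fin c.1.len))
    (y : (N.obj c.1.tree).X c.1.deg) :
    cobarMk N S n c y = Equiv.Perm.sign σ • cobarMk N S n ⟨c.1.perm σ, c.2⟩ y := by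
  rw [Units.smul_def, cobarMk, cobarMk, ← map_zsmul, ← sub_eq_zero, ← map_sub]
  exact (Submodule.Quotient.mk_eq_zero _).2 (Submodule.subset_span (Or.inl ⟨c, σ, y, rfl⟩))

theorem cobarMk_transport (c : CobarCell S n) (T' : RTree) (γ : c.1.tree ≅ T')
    (y : (N.obj c.1.tree).X c.1.deg) :
    cobarMk N S n c y =
      cobarMk N S n ⟨c.1.transport γ, c.2⟩ (((N.map γ.hom).f c.1.deg).hom y) := by
  rw [← sub_eq_zero, cobarMk, cobarMk, ← map_sub]
  exact (Submodule.Quotient.mk_eq_zero _).2 (Submodule.subset_span (Or.inr ⟨c, T', γ, y, rfl⟩))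

theorem cobar_hom_ext {W : Type*} [AddCommGroup W] [Module k W] {f g : cobarModule N S n →ₗ[k] W}
    (h : ∀ (c : CobarCell S n) (y : (N.obj c.1.tree).X c.1.deg),
      f (cobarMk N S n c y) = g (cobarMk N S n c y)) : f = g := by
  classical
  refine Submodule.linearMap_qext _ (DirectSum.linearMap_ext k fun c => LinearMap.ext fun y => ?_)
  convert! h c y

open Classical in
theorem toModule_cobarLof {W : Type*} [AddCommGroup W] [Module k W]
    (ψ : ∀ c : CobarCell S n, (N.obj c.1.tree).X c.1.deg →ₗ[k] W)
    (c : CobarCell S n) (y : (N.obj c.1.tree).X c.1.deg) :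
    DirectSum.toModule k (CobarCell S n) W ψ (cobarLof N S n c y) = ψ c y := by
  unfold cobarLof
  rw [DirectSum.toModule_lof]

open Classical in
/-- A linear map out of the cobar construction, given on generators. -/
noncomputable def cobarLift {W : Type*} [AddCommGroup W] [Module k W]
    (ψ : ∀ c : CobarCell S n, (N.obj c.1.tree).X c.1.deg →ₗ[k] W)
    (h1 : ∀ (c : CobarCell S n) (σ : Equiv.Perm (Fin c.1.len)) (y : (N.obj c.1.tree).X c.1.deg),
      ψ c y = Equiv.Perm.sign σ • ψ ⟨c.1.perm σ, c.2⟩ y)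
    (h2 : ∀ (c : CobarCell S n) (T' : RTree) (γ : c.1.tree ≅ T') (y : (N.obj c.1.tree).X c.1.deg),
      ψ c y = ψ ⟨c.1.transport γ, c.2⟩ (((N.map γ.hom).f c.1.deg).hom y)) :
    cobarModule N S n →ₗ[k] W :=
  (cobarRel N S n).liftQ (DirectSum.toModule k (CobarCell S n) W ψ) <| by
    refine Submodule.span_le.2 ?_
    rintro _ (⟨c, σ, y, rfl⟩ | ⟨c, T', γ, y, rfl⟩)
    · change DirectSum.toModule k (CobarCell S n) W ψ _ = 0
      rw [map_sub, Units.smul_def, map_zsmul, toModule_cobarLof, toModule_cobarLof, ← Units.smul_def, ← h1, sub_self]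
    · change DirectSum.toModule k (CobarCell S n) W ψ _ = 0
      rw [map_sub, toModule_cobarLof, toModule_cobarLof, ← h2, sub_self]

theorem cobarLift_mk {W : Type*} [AddCommGroup W] [Module k W]
    (ψ : ∀ c : CobarCell S n, (N.obj c.1.tree).X c.1.deg →ₗ[k] W) (h1 h2)
    (c : CobarCell S n) (y : (N.obj c.1.tree).X c.1.deg) :
    cobarLift ψ h1 h2 (cobarMk N S n c y) = ψ c y := by
  exact toModule_cobarLof ψ c y

end Generators

/-- The family `(gα, g_* y ⊗ e)`. -/
noncomputable def cobarFam (N : CoPsh.{u, v} k) {S : RTree} (n : ℤ) {T : RTree} (α : S ⟶ T) (m : ℤ)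
    (q : ℕ) (h : m - q = n) (y : (N.obj T).X m) : Fam T q (cobarModule N S n) := fun X g e =>
  cobarMk N S n ⟨⟨X, α ≫ g, q, e, m⟩, h⟩ (((N.map g).f m).hom y)

/-- Conilpotence is what bounds the support: beyond some number of edges, g_* y is zero. The
relations defining the cobar construction give the two symmetries. -/
theorem cobarFam_isAlt {N : CoPsh.{u, v} k} (hN : IsConilpotent k N) {S : RTree} (n : ℤ)
    {T : RTree} (α : S ⟶ T) (m : ℤ) (q : ℕ) (h : m - q = n) (y : (N.obj T).X m) :
    (cobarFam N n α m q h y).IsAlt := by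
  obtain ⟨K, hK⟩ := (ArrowClass.finite_iff _).1 (hN T m y)
  refine ⟨fun X g e σ => ?_, fun X X' g e γ => ?_, K, fun X g e hX => ?_⟩
  · unfold cobarFam
    rw [cobarMk_perm ⟨⟨X, α ≫ g, q, e, m⟩, h⟩ σ, smul_smul, Int.units_mul_self, one_smul]
  · refine Eq.trans ?_ (cobarMk_transport ⟨⟨X, α ≫ g, q, e, m⟩, h⟩ X' γ _).symm
    exact congrArg _ (copsh_map_comp N g γ.hom m y)
  · have : ((N.map g).f m).hom y = 0 := by
      by_contra hne
      exact absurd (hK _ ⟨X, g, rfl, hne⟩) (not_le.2 hX)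
    unfold cobarFam
    rw [this, cobarMk_zero]

/-- Faces following β, applied to y, are faces applied to β_* y. It serves both the invariance of
the differential under isomorphisms and the computation of its square. -/
theorem cobarFam_precomp (N : CoPsh.{u, v} k) {S : RTree} (n : ℤ) {T T' : RTree} (α : S ⟶ T)
    (β : T ⟶ T') (m : ℤ) (q : ℕ) (h : m - q = n) (y : (N.obj T).X m) :
    (cobarFam N n α m q h y).precomp β =
      cobarFam N n (α ≫ β) m q h (((N.map β).f m).hom y) := by
  funext X g e
  exact congrArg _ (copsh_map_comp N β g m y)

theorem cobarDiff_eq (N : CoPsh.{u, v} k) (S : RTree) (n : ℤ) (c : CobarCell S n)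
    (y : (N.obj c.1.tree).X c.1.deg) :
    cobarDiff N S n c y = cobarMk N S (n - 1)
      ⟨c.1.withDeg (c.1.deg - 1), by have := c.2; dsimp only; omega⟩
      (((N.obj c.1.tree).d c.1.deg (c.1.deg - 1)).hom y) +
      c.1.deg.negOnePow • faceSum k (cobarFam N (n - 1) c.1.map c.1.deg (c.1.len + 1)
        (by have := c.2; push_cast; omega) y) c.1.enum := by
  rw [faceSum, smul_sub, ← add_sub_assoc]
  rfl

section Maps

variable {N N' : CoPsh.{u, v} k} (f : N ⟶ N')

/-- The action of a map of trees on the cobar construction in degree `n`. -/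
noncomputable def cobarRes (N : CoPsh.{u, v} k) {R S : RTree} (β : R ⟶ S) (n : ℤ) :
    cobarModule N S n →ₗ[k] cobarModule N R n :=
  cobarLift (fun c =>
    { toFun := fun y => cobarMk N R n ⟨c.1.precomp β, c.2⟩ y
      map_add' := fun y y' => cobarMk_add ⟨c.1.precomp β, c.2⟩ y y'
      map_smul' := fun r y => cobarMk_smul r ⟨c.1.precomp β, c.2⟩ y })
    (fun c σ y => cobarMk_perm ⟨c.1.precomp β, c.2⟩ σ y)
    (fun c T' γ y => cobarMk_transport ⟨c.1.precomp β, c.2⟩ T' γ y)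

theorem cobarRes_mk {R S : RTree} (β : R ⟶ S) (n : ℤ) (c : CobarCell S n)
    (y : (N.obj c.1.tree).X c.1.deg) :
    cobarRes N β n (cobarMk N S n c y) = cobarMk N R n ⟨c.1.precomp β, c.2⟩ y :=
  cobarLift_mk _ _ _ c y

/-- The action of a morphism of copresheaves on the cobar construction in degree `n`. -/
noncomputable def cobarPush (S : RTree) (n : ℤ) : cobarModule N S n →ₗ[k] cobarModule N' S n :=
  cobarLift (fun c =>
    { toFun := fun y => cobarMk N' S n c (((f.app c.1.tree).f c.1.deg).hom y)
      map_add' := fun y y' => by rw [map_add, cobarMk_add]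
      map_smul' := fun r y => by rw [map_smul, cobarMk_smul, RingHom.id_apply] })
    (fun c σ y => cobarMk_perm c σ _)
    (fun c T' γ y => (cobarMk_transport c T' γ _).trans
      (congrArg _ (copsh_naturality f γ.hom _ _).symm))

theorem cobarPush_mk (S : RTree) (n : ℤ) (c : CobarCell S n) (y : (N.obj c.1.tree).X c.1.deg) :
    cobarPush f S n (cobarMk N S n c y) =
      cobarMk N' S n c (((f.app c.1.tree).f c.1.deg).hom y) :=
  cobarLift_mk _ _ _ c y

end Maps

variable [CharZero k]

/-! ### The cobar differential and its square -/

section Differential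

variable {N : CoPsh.{u, v} k} (hN : IsConilpotent k N) (S : RTree) (n : ℤ)

/-- The differential of the cobar construction. -/
noncomputable def cobarD : cobarModule N S n →ₗ[k] cobarModule N S (n - 1) :=
  cobarLift (fun c =>
    { toFun := cobarDiff N S n c
      map_add' := fun y y' => by
        rw [cobarDiff_eq, cobarDiff_eq, cobarDiff_eq, map_add, cobarMk_add, add_add_add_comm,
          ← smul_add, ← faceSum_add (cobarFam_isAlt hN _ _ _ _ _ _) (cobarFam_isAlt hN _ _ _ _ _ _)]
        congr 3
        funext X g e
        exact (congrArg _ (map_add _ _ _)).trans (cobarMk_add _ _ _)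
      map_smul' := fun r y => by
        rw [cobarDiff_eq, cobarDiff_eq, map_smul, cobarMk_smul, RingHom.id_apply, smul_add,
          smul_comm r, ← faceSum_smul r (cobarFam_isAlt hN _ _ _ _ _ _)]
        congr 3
        funext X g e
        exact (congrArg _ (map_smul _ _ _)).trans (cobarMk_smul _ _ _) })
    (fun c σ y => by
      have hc := c.2
      change cobarDiff N S n c y =
        Equiv.Perm.sign σ • cobarDiff N S n ⟨c.1.perm σ, c.2⟩ y
      rw [cobarDiff_eq, cobarDiff_eq, smul_add]
      congr 1
      · exact cobarMk_perm ⟨c.1.withDeg (c.1.deg - 1), by dsimp only; omega⟩ σ _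
      · rw [smul_comm]
        refine congrArg _ ?_
        -- The relation has the sign on the opposite side from `faceSum_perm`; the square of the
        -- sign is one.
        refine Eq.trans ?_ (congrArg _
          (faceSum_perm (cobarFam_isAlt hN _ _ _ _ _ _) c.1.enum σ).symm)
        rw [smul_smul, Int.units_mul_self, one_smul])
    (fun c T' γ y => by
      have hc := c.2
      change cobarDiff N S n c y =
        cobarDiff N S n ⟨c.1.transport γ, c.2⟩ (((N.map γ.hom).f c.1.deg).hom y)
      rw [cobarDiff_eq, cobarDiff_eq]
      congr 1
      · refine (cobarMk_transport ⟨c.1.withDeg (c.1.deg - 1), by dsimp only; omega⟩ T' γ _).trans ?_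
        exact congrArg _ (hom_d_apply (N.map γ.hom) _ _ _)
      · refine congrArg _ ?_
        rw [← faceSum_iso (cobarFam_isAlt hN _ _ _ _ _ _) c.1.enum γ, cobarFam_precomp])

theorem cobarD_mk (c : CobarCell S n) (y : (N.obj c.1.tree).X c.1.deg) :
    cobarD hN S n (cobarMk N S n c y) = cobarDiff N S n c y :=
  cobarLift_mk _ _ _ c y

/-- As for the bar construction, now checked on generators: the mixed terms carry the signs of |y|
and of |∂y| = |y| - 1. -/
theorem cobarD_cobarD (x : cobarModule N S n) : cobarD hN S (n - 1) (cobarD hN S n x) = 0 := by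
  refine LinearMap.congr_fun (f := cobarD hN S (n - 1) ∘ₗ cobarD hN S n) (g := 0)
    (cobar_hom_ext fun c y => ?_) x
  have hc := c.2
  change cobarD hN S (n - 1) (cobarD hN S n _) = 0
  let A := cobarFam N (n - 1 - 1) c.1.map (c.1.deg - 1) (c.1.len + 1) (by push_cast; omega)
    (((N.obj c.1.tree).d c.1.deg (c.1.deg - 1)).hom y)
  have hA : A.IsAlt := cobarFam_isAlt hN _ _ _ _ _ _
  let B := cobarFam N (n - 1 - 1) c.1.map c.1.deg (c.1.len + 2) (by push_cast; omega) y
  have hB : B.IsAlt := cobarFam_isAlt hN _ _ _ _ _ _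
  have hAB : (fun X g e => cobarD hN S (n - 1) (cobarFam N (n - 1) c.1.map c.1.deg (c.1.len + 1)
      (by push_cast; omega) y X g e)) =
      A + fun X g e => c.1.deg.negOnePow • B.faces k X g e := by
    funext X g e
    change _ = A X g e + c.1.deg.negOnePow • B.faces k X g e
    refine (cobarD_mk hN S (n - 1) _ _).trans ((cobarDiff_eq _ _ _ _ _).trans ?_)
    congr 1
    · exact congrArg _ (hom_d_apply (N.map g) _ _ _).symm
    · refine congrArg _ ?_
      unfold Fam.faces
      rw [cobarFam_precomp]
  rw [cobarD_mk, cobarDiff_eq, map_add, cobarD_mk, cobarDiff_eq, d_d_apply, cobarMk_zero, zero_add,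
    Units.smul_def c.1.deg.negOnePow, map_zsmul, ← Units.smul_def,
    map_faceSum _ (cobarFam_isAlt hN _ _ _ _ _ _), hAB, faceSum_add hA,
    faceSum_negOnePow_smul c.1.deg hB.faces, faceSum_faces hB,
    smul_zero, add_zero, Int.negOnePow_sub, Int.negOnePow_one, mul_neg, mul_one, Units.neg_smul]
  · exact neg_add_cancel _
  · exact hB.faces.map (DistribSMul.toAddMonoidHom _ c.1.deg.negOnePow)

/-- The cobar construction at `S`. -/
noncomputable def cobarComplex : ChainComplex (ModuleCat.{v} k) ℤ :=
  chainComplexOf (fun n => ModuleCat.of k (cobarModule N S n))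
    (fun n => ModuleCat.ofHom (cobarD hN S n))
    fun n => ModuleCat.hom_ext (LinearMap.ext fun x => cobarD_cobarD hN S n x)

theorem cobarComplex_d : (cobarComplex hN S).d n (n - 1) = ModuleCat.ofHom (cobarD hN S n) :=
  chainComplexOf_d _ _ _ n

theorem cobarComplex_d_apply (x : cobarModule N S n) :
    ((cobarComplex hN S).d n (n - 1)).hom x = cobarD hN S n x :=
  congrArg (fun f => f.hom x) (cobarComplex_d hN S n)

theorem cobarComplex_d_mk (c : CobarCell S n) (y : (N.obj c.1.tree).X c.1.deg) :
    ((cobarComplex hN S).d n (n - 1)).hom (cobarMk N S n c y) = cobarDiff N S n c y :=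
  (cobarComplex_d_apply hN S n _).trans (cobarD_mk hN S n c y)

end Differential

/-- A chain map out of the cobar construction, given by linear maps in each degree. -/
noncomputable def cobarDesc {N : CoPsh.{u, v} k} (hN : IsConilpotent k N) {S : RTree}
    {A : ChainComplex (ModuleCat.{v} k) ℤ} (f : ∀ n, cobarModule N S n →ₗ[k] A.X n)
    (h : ∀ n (c : CobarCell S n) (y : (N.obj c.1.tree).X c.1.deg),
      (A.d n (n - 1)).hom (f n (cobarMk N S n c y)) = f (n - 1) (cobarDiff N S n c y)) :
    cobarComplex hN S ⟶ A :=
  chainMapOf (fun n => ModuleCat.ofHom (X := cobarModule N S n) (f n)) fun n => by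
    rw [cobarComplex_d]
    refine ModuleCat.hom_ext (cobar_hom_ext fun c y => ?_)
    exact (h n c y).trans (congrArg (f (n - 1)) (cobarD_mk hN S n c y).symm)

theorem cobarComplex_hom_ext {N : CoPsh.{u, v} k} (hN : IsConilpotent k N) {S : RTree}
    {A : ChainComplex (ModuleCat.{v} k) ℤ} {f g : cobarComplex hN S ⟶ A}
    (h : ∀ n (c : CobarCell S n) (y : (N.obj c.1.tree).X c.1.deg),
      (f.f n).hom (cobarMk N S n c y) = (g.f n).hom (cobarMk N S n c y)) : f = g :=
  HomologicalComplex.Hom.ext (funext fun n => ModuleCat.hom_ext (cobar_hom_ext (h n)))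

section Functor

variable {N : CoPsh.{u, v} k} (hN : IsConilpotent k N)

theorem cobarD_cobarRes {R S : RTree} (β : R ⟶ S) (n : ℤ) (c : CobarCell S n)
    (y : (N.obj c.1.tree).X c.1.deg) :
    cobarD hN R n (cobarRes N β n (cobarMk N S n c y)) =
      cobarRes N β (n - 1) (cobarDiff N S n c y) := by
  rw [cobarRes_mk, cobarD_mk, cobarDiff_eq, cobarDiff_eq, map_add, Units.smul_def,
    Units.smul_def, map_zsmul, map_faceSum _ (cobarFam_isAlt hN _ _ _ _ _ _)]
  have hc := c.2
  congr 1
  · exact (cobarRes_mk β (n - 1) ⟨c.1.withDeg (c.1.deg - 1), by dsimp only; omega⟩ _).symm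
  congr 2
  funext X g e
  exact (cobarRes_mk β (n - 1)
    ⟨⟨X, c.1.map ≫ g, c.1.len + 1, e, c.1.deg⟩, by push_cast; omega⟩ _).symm

/-- The action of a map of trees on the cobar construction. -/
noncomputable def cobarMap {R S : RTree} (β : R ⟶ S) : cobarComplex hN S ⟶ cobarComplex hN R :=
  cobarDesc hN (A := cobarComplex hN R) (cobarRes N β) fun n c y =>
    (cobarComplex_d_apply hN R n _).trans (cobarD_cobarRes hN β n c y)

theorem cobarMap_mk {R S : RTree} (β : R ⟶ S) (n : ℤ) (c : CobarCell S n)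
    (y : (N.obj c.1.tree).X c.1.deg) :
    ((cobarMap hN β).f n).hom (cobarMk N S n c y) = cobarMk N R n ⟨c.1.precomp β, c.2⟩ y :=
  cobarRes_mk β n c y

/-- The cobar construction of a conilpotent copresheaf. -/
noncomputable def cobarPsh : Psh.{u, v} k where
  obj S := cobarComplex hN S.unop
  map β := cobarMap hN β.unop
  map_id S := cobarComplex_hom_ext hN fun n c y => cobarMap_mk hN (𝟙 S.unop) n c y
  map_comp {R S T} β β' := cobarComplex_hom_ext hN fun n c y => by
    refine (cobarMap_mk hN (β ≫ β').unop n c y).trans ?_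
    exact ((congrArg ((cobarMap hN β'.unop).f n).hom (cobarMap_mk hN β.unop n c y)).trans
      (cobarMap_mk hN β'.unop n ⟨c.1.precomp β.unop, c.2⟩ y)).symm

variable {N' : CoPsh.{u, v} k} (hN' : IsConilpotent k N') (f : N ⟶ N')

theorem cobarD_cobarPush {N N' : CoPsh.{u, v} k} (hN : IsConilpotent k N)
    (hN' : IsConilpotent k N') (f : N ⟶ N') (S : RTree) (n : ℤ) (c : CobarCell S n)
    (y : (N.obj c.1.tree).X c.1.deg) :
    cobarD hN' S n (cobarPush f S n (cobarMk N S n c y)) =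
      cobarPush f S (n - 1) (cobarDiff N S n c y) := by
  rw [cobarPush_mk, cobarD_mk, cobarDiff_eq, cobarDiff_eq, map_add, cobarPush_mk, Units.smul_def,
    Units.smul_def, map_zsmul, map_faceSum _ (cobarFam_isAlt hN _ _ _ _ _ _)]
  congr 1
  · exact congrArg _ (hom_d_apply (f.app c.1.tree) _ _ _).symm
  congr 2
  funext X g e
  exact ((cobarPush_mk f S _ _ _).trans (congrArg _ (copsh_naturality f g _ _))).symm

/-- The action of a morphism of copresheaves on the cobar construction at `S`. -/
noncomputable def cobarAppAt (S : RTree) : cobarComplex hN S ⟶ cobarComplex hN' S :=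
  cobarDesc hN (A := cobarComplex hN' S) (cobarPush f S) fun n c y =>
    (cobarComplex_d_apply hN' S n _).trans (cobarD_cobarPush hN hN' f S n c y)

theorem cobarAppAt_mk (S : RTree) (n : ℤ) (c : CobarCell S n) (y : (N.obj c.1.tree).X c.1.deg) :
    ((cobarAppAt hN hN' f S).f n).hom (cobarMk N S n c y) =
      cobarMk N' S n c (((f.app c.1.tree).f c.1.deg).hom y) :=
  cobarPush_mk f S n c y

/-- The action of a morphism of copresheaves on the cobar construction. -/
noncomputable def cobarApp : cobarPsh hN ⟶ cobarPsh hN' where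
  app S := cobarAppAt hN hN' f S.unop
  naturality R S β := cobarComplex_hom_ext hN fun n c y => by
    refine (congrArg ((cobarAppAt hN hN' f S.unop).f n).hom (cobarMap_mk hN β.unop n c y)).trans
      ((cobarAppAt_mk hN hN' f S.unop n ⟨c.1.precomp β.unop, c.2⟩ y).trans ?_)
    exact ((congrArg ((cobarMap hN' β.unop).f n).hom (cobarAppAt_mk hN hN' f R.unop n c y)).trans
      (cobarMap_mk hN' β.unop n c _)).symm

end Functor

variable (k) in
/-- The cobar functor. -/
noncomputable def cobarFunctor : ConilpCoPsh.{u, v} k ⥤ Psh.{u, v} k where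
  obj N := cobarPsh N.property
  map {N N'} f := cobarApp N.property N'.property f.hom
  map_id N := NatTrans.ext (funext fun S => cobarComplex_hom_ext N.property fun n c y =>
    cobarAppAt_mk N.property N.property (𝟙 N.obj) S.unop n c y)
  map_comp {N N' N''} f g := NatTrans.ext (funext fun S =>
    cobarComplex_hom_ext N.property fun n c y => by
      refine (cobarAppAt_mk N.property N''.property (f.hom ≫ g.hom) S.unop n c y).trans ?_
      exact ((congrArg ((cobarAppAt N'.property N''.property g.hom S.unop).f n).hom
        (cobarAppAt_mk N.property N'.property f.hom S.unop n c y)).trans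
        (cobarAppAt_mk N'.property N''.property g.hom S.unop n c _)).symm)

theorem isCobarFunctor_cobarFunctor : IsCobarFunctor (cobarFunctor.{u, v} k) :=
  ⟨fun N S n => LinearEquiv.refl k (cobarModule N.obj S n),
    fun N S n c y => cobarComplex_d_mk N.property S n c y,
    fun N _ _ β n c y => cobarMap_mk N.property β n c y,
    fun N N' f S n c y => cobarAppAt_mk N.property N'.property f.hom S n c y⟩

end Cobar

/-! ### The adjunction -/

section Adjunction

variable {k : Type u} [Field k]

theorem map_intUnits_smul {V W : Type*} [AddCommGroup V] [AddCommGroup W] [Module k V] [Module k W]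
    (φ : V →ₗ[k] W) (ε : ℤˣ) (x : V) : φ (ε • x) = ε • φ x := by
  rw [Units.smul_def, map_zsmul, ← Units.smul_def]

theorem negOnePow_natCast_succ (q : ℕ) :
    ((q + 1 : ℕ) : ℤ).negOnePow = -(q : ℤ).negOnePow := by
  push_cast
  exact Int.negOnePow_succ _

/-- The degree m' is a separate variable because in the adjunction it is related to m only by a
provable equation. -/
theorem barDiff_apply (M : Psh.{u, v} k) {S T : RTree} {n : ℤ} (ω : BarFamily M S n) (α : S ⟶ T)
    {q : ℕ} (e : Enum T q) {m m' : ℤ} (hm : m' = m + 1) (h : m + q = n - 1) :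
    barDiff M S n ω ⟨⟨T, α, q, e, m⟩, h⟩ = ((M.obj (op T)).d m' m).hom
      (ω ⟨⟨T, α, q, e, m'⟩, by dsimp only; omega⟩) +
      n.negOnePow • faceSum k (barFam M ω α m (q + 1) (by push_cast; omega)) e := by
  subst hm
  exact barDiff_eq M S n ω _

/-- The linear map `y ↦ (-1)^p (id, y ⊗ e)`. -/
noncomputable def unitVal (N : CoPsh.{u, v} k) {T : RTree} {q : ℕ} (e : Enum T q) (n m : ℤ)
    (h : n - q = m) : (N.obj T).X n →ₗ[k] cobarModule N T m where
  toFun y := (q : ℤ).negOnePow • cobarMk N T m ⟨⟨T, 𝟙 T, q, e, n⟩, h⟩ y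
  map_add' y y' := by rw [cobarMk_add, smul_add]
  map_smul' r y := by rw [cobarMk_smul, smul_comm, RingHom.id_apply]

theorem unitVal_apply (N : CoPsh.{u, v} k) {T : RTree} {q : ℕ} (e : Enum T q) {n m : ℤ}
    (h : n - q = m) (y : (N.obj T).X n) :
    unitVal N e n m h y = (q : ℤ).negOnePow • cobarMk N T m ⟨⟨T, 𝟙 T, q, e, n⟩, h⟩ y := rfl

theorem unitVal_perm (N : CoPsh.{u, v} k) {T : RTree} {q : ℕ} (e : Enum T q) {n m : ℤ}
    (h : n - q = m) (y : (N.obj T).X n) (σ : Equiv.Perm (Fin q)) :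
    unitVal N (e.perm σ) n m h y = Equiv.Perm.sign σ • unitVal N e n m h y := by
  rw [unitVal_apply, unitVal_apply, cobarMk_perm ⟨⟨T, 𝟙 T, q, e, n⟩, h⟩ σ,
    smul_comm (Equiv.Perm.sign σ), smul_smul (Equiv.Perm.sign σ), Int.units_mul_self, one_smul]

/-- Every generator is, up to sign, the restriction of one over the identity; this is why the unit
only needs the symbols (id, y ⊗ e). -/
theorem cobarRes_unitVal (N : CoPsh.{u, v} k) {R T : RTree} (β : R ⟶ T) {q : ℕ} (e : Enum T q)
    {n m : ℤ} (h : n - q = m) (y : (N.obj T).X n) :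
    cobarRes N β m (unitVal N e n m h y) =
      (q : ℤ).negOnePow • cobarMk N R m ⟨⟨T, β, q, e, n⟩, h⟩ y := by
  rw [unitVal_apply, map_intUnits_smul, cobarRes_mk]
  rfl

theorem cobarRes_unitVal_transport (N : CoPsh.{u, v} k) {T T' : RTree} (γ : T ≅ T') {q : ℕ}
    (e : Enum T q) {n m : ℤ} (h : n - q = m) (y : (N.obj T).X n) :
    cobarRes N γ.hom m (unitVal N (e.transport γ) n m h (((N.map γ.hom).f n).hom y)) =
      unitVal N e n m h y := by
  rw [cobarRes_unitVal, unitVal_apply, cobarMk_transport ⟨⟨T, 𝟙 T, q, e, n⟩, h⟩ T' γ y]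
  rfl

/-- The linear map `ω ↦ (-1)^p ω_id(e)`. -/
noncomputable def barEval (M : Psh.{u, v} k) {T : RTree} {q : ℕ} (e : Enum T q) (m n : ℤ) (h : m - q = n) :
    barModule M T m →ₗ[k] (M.obj (op T)).X n where
  toFun ω := (q : ℤ).negOnePow • ω.1 ⟨⟨T, 𝟙 T, q, e, n⟩, by dsimp only; omega⟩
  map_add' ω ω' := smul_add _ _ _
  map_smul' r ω := smul_comm _ _ _

theorem barEval_apply (M : Psh.{u, v} k) {T : RTree} {q : ℕ} (e : Enum T q) {m n : ℤ} (h : m - q = n)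
    (ω : barModule M T m) : barEval M e m n h ω =
      (q : ℤ).negOnePow • ω.1 ⟨⟨T, 𝟙 T, q, e, n⟩, by dsimp only; omega⟩ := rfl

theorem barEval_perm (M : Psh.{u, v} k) {T : RTree} {q : ℕ} (e : Enum T q) {m n : ℤ} (h : m - q = n)
    (ω : barModule M T m) (σ : Equiv.Perm (Fin q)) :
    barEval M e m n h ω = Equiv.Perm.sign σ • barEval M (e.perm σ) m n h ω := by
  have h1 := ω.2.1 ⟨⟨T, 𝟙 T, q, e, n⟩, by dsimp only; omega⟩ σ
  refine Eq.trans ?_ (congrArg (fun z => Equiv.Perm.sign σ • (q : ℤ).negOnePow • z) h1).symm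
  rw [smul_comm, smul_smul (Equiv.Perm.sign σ), Int.units_mul_self, one_smul]
  rfl

theorem barEval_transport (M : Psh.{u, v} k) {T T' : RTree} (γ : T ≅ T') {q : ℕ} (e : Enum T q) {m n : ℤ}
    (h : m - q = n) (ω : barModule M T m) :
    barEval M e m n h ω = ((M.map γ.hom.op).f n).hom
      (barEval M (e.transport γ) m n h (barPush M γ.hom m ω)) := by
  have h1 := ω.2.2.1 ⟨⟨T, 𝟙 T, q, e, n⟩, by dsimp only; omega⟩ T' γ
  rw [barEval_apply, barEval_apply, map_intUnits_smul]
  exact congrArg ((q : ℤ).negOnePow • ·) h1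

variable [CharZero k]

theorem cobarComplex_d_apply_mk {N : CoPsh.{u, v} k} (hN : IsConilpotent k N) {S T : RTree}
    {i j : ℤ} (hij : j = i - 1) (α : S ⟶ T) {q : ℕ} (e : Enum T q) {m : ℤ} (h : m - q = i)
    (y : (N.obj T).X m) :
    @Eq (cobarModule N S j)
      (((cobarComplex hN S).d i j).hom (cobarMk N S i ⟨⟨T, α, q, e, m⟩, h⟩ y))
      (cobarMk N S j ⟨⟨T, α, q, e, m - 1⟩, by dsimp only; omega⟩
        (((N.obj T).d m (m - 1)).hom y) +
      m.negOnePow • faceSum k (cobarFam N j α m (q + 1) (by push_cast; omega) y) e) := by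
  subst hij
  exact (cobarComplex_d_mk hN S i ⟨⟨T, α, q, e, m⟩, h⟩ y).trans
    (cobarDiff_eq N S i ⟨⟨T, α, q, e, m⟩, h⟩ y)

/-! ### The unit of the adjunction -/

section Unit

variable {N : CoPsh.{u, v} k} (hN : IsConilpotent k N)

/-- The face terms acquire a minus sign because `unitVal` carries (-1)^q on enumerations of length q
and a face lengthens them by one. -/
theorem d_unitVal {T : RTree} {q : ℕ} (e : Enum T q) {n m m' : ℤ} (hm : m = m' - 1)
    (h : n - q = m') (y : (N.obj T).X n) :
    ((cobarComplex hN T).d m' m).hom (unitVal N e n m' h y) =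
      unitVal N e (n - 1) m (by omega) (((N.obj T).d n (n - 1)).hom y) -
        n.negOnePow • faceSum k (fun X g (e' : Enum X (q + 1)) => cobarRes N g m
          (unitVal N e' n m (by push_cast; omega) (((N.map g).f n).hom y))) e := by
  have h1 : (fun X g (e' : Enum X (q + 1)) => cobarRes N g m
      (unitVal N e' n m (by push_cast; omega) (((N.map g).f n).hom y))) =
      fun X g e' => ((q + 1 : ℕ) : ℤ).negOnePow •
        cobarFam N m (𝟙 T) n (q + 1) (by push_cast; omega) y X g e' := by
    funext X g e'
    exact cobarRes_unitVal N g e' _ _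
  rw [h1, faceSum_negOnePow_smul _ (cobarFam_isAlt hN _ _ _ _ _ _), unitVal_apply, unitVal_apply,
    negOnePow_natCast_succ, Units.neg_smul, smul_neg, sub_neg_eq_add, smul_comm n.negOnePow,
    ← smul_add]
  refine (map_intUnits_smul ((cobarComplex hN T).d m' m).hom _ _).trans ?_
  exact congrArg (fun z : cobarModule N T m => (q : ℤ).negOnePow • z)
    (cobarComplex_d_apply_mk hN hm (𝟙 T) e h y)

variable (S : RTree) (n : ℤ)

/-- The family `(-1)^p (id, α_* y ⊗ e)`. -/
noncomputable def unitFamily (y : (N.obj S).X n) : BarFamily (cobarPsh hN) S n := fun c =>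
  unitVal N c.1.enum n c.1.deg (by have := c.2; omega) (((N.map c.1.map).f n).hom y)

/-- The relations in the cobar construction give the two symmetries; conilpotence of N gives the
finite support. -/
theorem unitFamily_mem (y : (N.obj S).X n) :
    unitFamily hN S n y ∈ barModule (cobarPsh hN) S n := by
  obtain ⟨K, hK⟩ := (ArrowClass.finite_iff _).1 (hN S n y)
  refine (mem_barModule_iff _).2 ⟨fun c σ => ?_, fun c T' γ => ?_, K, fun c hc => ?_⟩
  · exact unitVal_perm N c.1.enum _ _ σ
  · refine (cobarRes_unitVal_transport N γ c.1.enum (by have := c.2; omega) _).symm.trans ?_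
    refine congrArg (fun z => cobarRes N γ.hom c.1.deg (unitVal N (c.1.enum.transport γ) n c.1.deg
      (by have := c.2; omega) z)) ?_
    exact (copsh_map_comp N c.1.map γ.hom n y).symm
  · have h0 : ((N.map c.1.map).f n).hom y = 0 := by
      by_contra hne
      exact absurd (hK _ ⟨_, c.1.map, rfl, hne⟩) (not_le.2 hc)
    unfold unitFamily
    rw [h0]
    exact map_zero _

/-- The face terms of the cobar differential inside each value, negated as in `d_unitVal`, cancel
those of the bar differential. Only the internal differential of N is left. -/
theorem barDiff_unitFamily (y : (N.obj S).X n) :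
    barDiff (cobarPsh hN) S n (unitFamily hN S n y) =
      unitFamily hN S (n - 1) (((N.obj S).d n (n - 1)).hom y) := by
  funext ⟨⟨T, α, q, e, m⟩, h⟩
  replace h : m + q = n - 1 := h
  rw [barDiff_apply (cobarPsh hN) _ α e rfl h]
  have h1 := d_unitVal hN e (m := m) (m' := m + 1) (by omega) (by omega) (((N.map α).f n).hom y)
  have h2 : barFam (cobarPsh hN) (unitFamily hN S n y) α m (q + 1) (by push_cast; omega) =
      fun X g (e' : Enum X (q + 1)) => cobarRes N g m (unitVal N e' n m (by push_cast; omega)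
        (((N.map g).f n).hom (((N.map α).f n).hom y))) := by
    funext X g e'
    refine congrArg (fun z => cobarRes N g m (unitVal N e' n m (by push_cast; omega) z)) ?_
    exact copsh_map_comp N α g n y
  rw [h2]
  refine (congrArg (fun z : cobarModule N T m => z + n.negOnePow • faceSum k
    (fun X g (e' : Enum X (q + 1)) => cobarRes N g m (unitVal N e' n m (by push_cast; omega)
        (((N.map g).f n).hom (((N.map α).f n).hom y)))) e) h1).trans ?_
  rw [sub_add_cancel]
  exact congrArg (unitVal N e (n - 1) m (by omega)) (hom_d_apply (N.map α) _ _ _).symm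

/-- The unit of the adjunction at `S`. -/
noncomputable def unitAt : N.obj S ⟶ barComplex (cobarPsh hN) S :=
  chainMapOf (fun n => ModuleCat.ofHom (Y := barModule (cobarPsh hN) S n)
    { toFun := fun y => ⟨unitFamily hN S n y, unitFamily_mem hN S n y⟩
      map_add' := fun y y' => Subtype.ext (funext fun c =>
        map_add (unitVal N c.1.enum n c.1.deg (by have := c.2; omega) ∘ₗ
          ((N.map c.1.map).f n).hom) y y')
      map_smul' := fun r y => Subtype.ext (funext fun c =>
        map_smul (unitVal N c.1.enum n c.1.deg (by have := c.2; omega) ∘ₗ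
          ((N.map c.1.map).f n).hom) r y) }) fun n => by
    rw [barComplex_d]
    exact ModuleCat.hom_ext (LinearMap.ext fun y => Subtype.ext (barDiff_unitFamily hN S n y))

/-- The unit of the adjunction. -/
noncomputable def unitCoPsh : N ⟶ barCoPsh (cobarPsh hN) where
  app S := unitAt hN S
  naturality _ _ β := HomologicalComplex.Hom.ext (funext fun n =>
    ModuleCat.hom_ext (LinearMap.ext fun y => Subtype.ext (funext fun c =>
      congrArg (unitVal N c.1.enum n c.1.deg (by have := c.2; omega))
        (copsh_map_comp N β c.1.map n y).symm)))

end Unit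

/-! ### The counit of the adjunction -/

section Counit

variable (M : Psh.{u, v} k)

/-- The dual of `d_unitVal`: evaluation after a face carries one more sign than evaluation before
it, which turns the plus of the bar differential into a minus. -/
theorem barEval_barD {T : RTree} {q : ℕ} (e : Enum T q) {m n : ℤ} (h : m - q = n)
    (ω : barModule M T m) :
    barEval M e (m - 1) (n - 1) (by omega) (barD M T m ω) =
      ((M.obj (op T)).d n (n - 1)).hom (barEval M e m n h ω) -
        m.negOnePow • faceSum k (fun X g (e' : Enum X (q + 1)) => ((M.map g.op).f (n - 1)).hom
          (barEval M e' m (n - 1) (by push_cast; omega) (barPush M g m ω))) e := by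
  have h1 : (fun X g (e' : Enum X (q + 1)) => ((M.map g.op).f (n - 1)).hom
      (barEval M e' m (n - 1) (by push_cast; omega) (barPush M g m ω))) =
      fun X g e' => ((q + 1 : ℕ) : ℤ).negOnePow • barFam M ω.1 (𝟙 T) (n - 1) (q + 1)
        (by push_cast; omega) X g e' := by
    funext X g e'
    exact map_intUnits_smul _ _ _
  have h2 := barDiff_apply M ω.1 (𝟙 T) e (m := n - 1) (m' := n) (by omega) (by omega)
  rw [h1, faceSum_negOnePow_smul _ (barFam_isAlt ω.2 _ _ _ _), barEval_apply, barEval_apply,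
    negOnePow_natCast_succ, Units.neg_smul, smul_neg, sub_neg_eq_add, smul_comm m.negOnePow,
    map_intUnits_smul, ← smul_add]
  exact congrArg ((q : ℤ).negOnePow • ·) h2

variable (S : RTree) (n : ℤ)

/-- The counit of the adjunction at `S` in degree `n`: the linear map
`(α, ω ⊗ e) ↦ (-1)^p α^* ω_id(e)`. -/
noncomputable def counitLin : cobarModule (barCoPsh M) S n →ₗ[k] (M.obj (op S)).X n :=
  cobarLift (N := barCoPsh M)
    (fun c => ((M.map c.1.map.op).f n).hom ∘ₗ barEval M c.1.enum c.1.deg n c.2)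
    (fun c σ ω => (congrArg ((M.map c.1.map.op).f n).hom
      (barEval_perm M c.1.enum c.2 ω σ)).trans (map_intUnits_smul _ _ _))
    (fun c _ γ ω => (congrArg ((M.map c.1.map.op).f n).hom
      (barEval_transport M γ c.1.enum c.2 ω)).trans (psh_map_comp M c.1.map γ.hom n _).symm)

theorem counitLin_mk (c : CobarCell S n) (ω : ((barCoPsh M).obj c.1.tree).X c.1.deg) :
    counitLin M S n (cobarMk (barCoPsh M) S n c ω) =
      ((M.map c.1.map.op).f n).hom (barEval M c.1.enum c.1.deg n c.2 ω) :=
  cobarLift_mk (N := barCoPsh M) _ _ _ c ω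

/-- The face terms of the cobar differential cancel those that the bar differential of ω contributes
through `barEval_barD`. -/
theorem counitLin_cobarDiff (c : CobarCell S n) (ω : ((barCoPsh M).obj c.1.tree).X c.1.deg) :
    ((M.obj (op S)).d n (n - 1)).hom (counitLin M S n (cobarMk (barCoPsh M) S n c ω)) =
      counitLin M S (n - 1) (cobarDiff (barCoPsh M) S n c ω) := by
  have hM := barCoPsh_isConilpotent M
  have hc := c.2
  have h0 := cobarFam_isAlt hM (n - 1) c.1.map c.1.deg (c.1.len + 1) (by push_cast; omega) ω
  have h3 := cobarFam_isAlt hM (n - 1) (𝟙 c.1.tree) c.1.deg (c.1.len + 1) (by push_cast; omega) ω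
  let F : Fam c.1.tree (c.1.len + 1) ((M.obj (op c.1.tree)).X (n - 1)) := fun X g e' =>
    ((M.map g.op).f (n - 1)).hom (barEval M e' c.1.deg (n - 1) (by push_cast; omega)
      (barPush M g c.1.deg ω))
  -- F is the image under the counit of the family of generators over the identity, so it inherits
  -- the symmetries and the bound.
  have hF : F.IsAlt := by
    have : F = fun X g e' => counitLin M c.1.tree (n - 1)
        (cobarFam (barCoPsh M) (n - 1) (𝟙 c.1.tree) c.1.deg (c.1.len + 1) (by push_cast; omega) ω
          X g e') := by
      funext X g e'
      exact (counitLin_mk M c.1.tree (n - 1)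
        ⟨⟨X, g, c.1.len + 1, e', c.1.deg⟩, by push_cast; omega⟩ _).symm
    rw [this]
    exact h3.map (counitLin M c.1.tree (n - 1)).toAddMonoidHom
  have h1 : counitLin M S (n - 1) (cobarMk (barCoPsh M) S (n - 1)
      ⟨c.1.withDeg (c.1.deg - 1), by dsimp only; omega⟩
      ((((barCoPsh M).obj c.1.tree).d c.1.deg (c.1.deg - 1)).hom ω)) =
      ((M.map c.1.map.op).f (n - 1)).hom (((M.obj (op c.1.tree)).d n (n - 1)).hom
        (barEval M c.1.enum c.1.deg n c.2 ω) - c.1.deg.negOnePow • faceSum k F c.1.enum) := by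
    refine (counitLin_mk M S (n - 1)
      ⟨c.1.withDeg (c.1.deg - 1), by dsimp only; omega⟩ _).trans (congrArg _ ?_)
    refine Eq.trans ?_ (barEval_barD M c.1.enum c.2 ω)
    exact congrArg _ (barComplex_d_apply M c.1.tree c.1.deg ω)
  have h2 : (fun X g e' => counitLin M S (n - 1) (cobarFam (barCoPsh M) (n - 1) c.1.map c.1.deg
      (c.1.len + 1) (by push_cast; omega) ω X g e')) =
      fun X g e' => ((M.map c.1.map.op).f (n - 1)).hom (F X g e') := by
    funext X g e'
    refine (counitLin_mk M S (n - 1)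
      ⟨⟨X, c.1.map ≫ g, c.1.len + 1, e', c.1.deg⟩, by push_cast; omega⟩ _).trans ?_
    exact psh_map_comp M c.1.map g (n - 1) _
  rw [counitLin_mk, cobarDiff_eq, map_add, map_intUnits_smul, map_faceSum _ h0, h1, h2,
    ← map_faceSum _ hF, ← map_intUnits_smul, ← map_add, sub_add_cancel]
  exact (hom_d_apply (M.map c.1.map.op) _ _ _).symm

/-- The counit of the adjunction at `S`. -/
noncomputable def counitAt :
    cobarComplex (barCoPsh_isConilpotent M) S ⟶ M.obj (op S) :=
  cobarDesc _ (counitLin M S) fun n c ω => counitLin_cobarDiff M S n c ω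

/-- The counit of the adjunction. -/
noncomputable def counitPsh : cobarPsh (barCoPsh_isConilpotent M) ⟶ M where
  app S := counitAt M S.unop
  naturality S R β := cobarComplex_hom_ext _ fun n c ω => by
    refine (congrArg (counitLin M R.unop n)
      (cobarMap_mk (barCoPsh_isConilpotent M) β.unop n c ω)).trans ?_
    refine (counitLin_mk M R.unop n ⟨c.1.precomp β.unop, c.2⟩ ω).trans ?_
    refine Eq.trans ?_ (congrArg ((M.map β).f n).hom (counitLin_mk M S.unop n c ω)).symm
    exact psh_map_comp M β.unop c.1.map n _

end Counit

/-! ### Naturality and the triangle identities -/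

theorem unit_naturality {N N' : CoPsh.{u, v} k} (hN : IsConilpotent k N) (hN' : IsConilpotent k N')
    (f : N ⟶ N') : f ≫ unitCoPsh hN' = unitCoPsh hN ≫ barApp (cobarApp hN hN' f) := by
  refine NatTrans.ext (funext fun S => HomologicalComplex.Hom.ext (funext fun n =>
    ModuleCat.hom_ext (LinearMap.ext fun y => Subtype.ext (funext fun c => ?_))))
  have h := c.2
  have h1 : cobarPush f c.1.tree c.1.deg (unitVal N c.1.enum n c.1.deg (by omega)
      (((N.map c.1.map).f n).hom y)) = unitVal N' c.1.enum n c.1.deg (by omega)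
      (((N'.map c.1.map).f n).hom (((f.app S).f n).hom y)) := by
    rw [unitVal_apply, unitVal_apply, map_intUnits_smul, cobarPush_mk, copsh_naturality]
  exact h1.symm

theorem counit_naturality {M M' : Psh.{u, v} k} (f : M ⟶ M') :
    cobarApp (barCoPsh_isConilpotent M) (barCoPsh_isConilpotent M') (barApp f) ≫ counitPsh M' =
      counitPsh M ≫ f := by
  refine NatTrans.ext (funext fun S => cobarComplex_hom_ext _ fun n c ω => ?_)
  refine (congrArg (counitLin M' S.unop n) (cobarAppAt_mk (barCoPsh_isConilpotent M)
    (barCoPsh_isConilpotent M') (barApp f) S.unop n c ω)).trans ?_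
  refine (counitLin_mk M' S.unop n c _).trans ?_
  refine Eq.trans ?_ (congrArg ((f.app S).f n).hom (counitLin_mk M S.unop n c ω)).symm
  refine Eq.trans (congrArg _ ?_) (psh_naturality f c.1.map n _).symm
  exact (map_intUnits_smul ((f.app (op c.1.tree)).f n).hom _ _).symm

/-- On (α, y ⊗ e), the counit evaluates the unit of y at the identity, giving (id, y ⊗ e) with the
sign (-1)^p twice, and restriction along α returns the generator. -/
theorem left_triangle {N : CoPsh.{u, v} k} (hN : IsConilpotent k N) :
    cobarApp hN (barCoPsh_isConilpotent (cobarPsh hN)) (unitCoPsh hN) ≫ counitPsh (cobarPsh hN) =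
      𝟙 (cobarPsh hN) := by
  refine NatTrans.ext (funext fun S => cobarComplex_hom_ext _ fun n c y => ?_)
  refine (congrArg (counitLin (cobarPsh hN) S.unop n)
    (cobarAppAt_mk hN (barCoPsh_isConilpotent _) (unitCoPsh hN) S.unop n c y)).trans ?_
  refine (counitLin_mk (cobarPsh hN) S.unop n c _).trans ?_
  have h : cobarRes N c.1.map n ((c.1.len : ℤ).negOnePow • unitVal N c.1.enum c.1.deg n c.2
      (((N.map (𝟙 c.1.tree)).f c.1.deg).hom y)) = cobarMk N S.unop n c y := by
    rw [map_intUnits_smul, cobarRes_unitVal, smul_smul, Int.units_mul_self, one_smul, copsh_map_id]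
  exact h

/-- At (α, e), the unit produces α_* ω over the identity, and the value of α_* ω at the identity is
ω_α(e). The sign (-1)^p again occurs twice. -/
theorem right_triangle (M : Psh.{u, v} k) :
    unitCoPsh (barCoPsh_isConilpotent M) ≫ barApp (counitPsh M) = 𝟙 (barCoPsh M) := by
  refine NatTrans.ext (funext fun S => HomologicalComplex.Hom.ext (funext fun n =>
    ModuleCat.hom_ext (LinearMap.ext fun (ω : barModule M S n) =>
      Subtype.ext (funext fun c => ?_))))
  have hc := c.2
  have key : ∀ z : ((barCoPsh M).obj c.1.tree).X n, counitLin M c.1.tree c.1.deg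
      (unitVal (barCoPsh M) c.1.enum n c.1.deg (by omega) z) =
      (c.1.len : ℤ).negOnePow • barEval M c.1.enum n c.1.deg (by omega) z := fun z => by
    rw [unitVal_apply, map_intUnits_smul, counitLin_mk, psh_map_id]
  refine (key (barPush M c.1.map n ω)).trans ((smul_smul _ _ _).trans ?_)
  rw [Int.units_mul_self, one_smul]
  rfl

variable (k) in
/-- The cobar functor is left adjoint to the bar functor. -/
noncomputable def cobarBarAdjunction : cobarFunctor.{u, v} k ⊣ barFunctor.{u, v} k where
  unit :=
    { app := fun N => ⟨unitCoPsh N.property⟩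
      naturality := fun N N' f =>
        ObjectProperty.hom_ext _ (unit_naturality N.property N'.property f.hom) }
  counit :=
    { app := fun M => counitPsh M
      naturality := fun _ _ f => counit_naturality f }
  left_triangle_components N := left_triangle N.property
  right_triangle_components M := ObjectProperty.hom_ext _ (right_triangle M)

end Adjunction

end BarCobar

theorem mainTheorem4 (k : Type u) [Field k] [CharZero k] :
    ∃ (B : BarCobar.Psh.{u, v} k ⥤ BarCobar.ConilpCoPsh.{u, v} k)
      (Ω : BarCobar.ConilpCoPsh.{u, v} k ⥤ BarCobar.Psh.{u, v} k),
      BarCobar.IsBarFunctor B ∧ BarCobar.IsCobarFunctor Ω ∧ Nonempty (Ω ⊣ B) :=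
  ⟨BarCobar.barFunctor k, BarCobar.cobarFunctor k, BarCobar.isBarFunctor_barFunctor,
    BarCobar.isCobarFunctor_cobarFunctor, ⟨BarCobar.cobarBarAdjunction k⟩⟩
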